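/- Let $n\ge 0$ and $p\ge 1$ be integers and let $V$ be a set with $n$ elements. Let $O(p,V)$ be the finite simplicial complex with vertex set $V\times\{0,\dots,p\}$ whose nonempty simplices are the sets $\{(v,g_v)\mid v\in U\}$, where $U$ is a nonempty subset of $V$ and $g=(g_v)_{v\in V}\in\{0,\dots,p\}^V$; that is, $O(p,V)$ is the join of $n$ copies of the discrete set $\{0,\dots,p\}$. Then $O(p,V)$ is $PH^{n-1}$: for every closed simplex $\sigma$ of $O(p,V)$, including the empty simplex, the reduced integral singular cohomology $\overline{H}^*(O(p,V)-\sigma)$ of the complement of $\sigma$ in the geometric realization of $O(p,V)$ is torsion-free and concentrated in degree $n-1$ (that is, it vanishes in every degree other than $n-1$). Here reduced cohomology is the cohomology of the augmented cochain complex, so that for $n=0$ the reduced cohomology of the empty space is $\mathbb{Z}$ in degree $-1$. -/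

import Mathlib

noncomputable section

/-- The `i`-th coface map from the standard simplex with `k` vertices to the standard simplex with
`k + 1` vertices: the inclusion of the face opposite to the vertex `i`. (For `k = 0` the source is
the standard simplex with no vertices, that is, the empty space.) -/
def coface (k : ℕ) (i : Fin (k + 1)) :
    C(stdSimplex ℝ (Fin k), stdSimplex ℝ (Fin (k + 1))) :=
  ⟨stdSimplex.map i.succAbove, stdSimplex.continuous_map i.succAbove⟩

/-- The group of augmented singular integral cochains of degree `k - 1`, namely all integer valued
functions on the set of singular simplices with `k` vertices. For `k = 0` there is exactly one such
simplex (the empty map), so that this is the group `ℤ` in degree `-1`. -/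
abbrev AugCochain (X : Type*) [TopologicalSpace X] (k : ℕ) : Type _ :=
  C(stdSimplex ℝ (Fin k), X) → ℤ

/-- The coboundary, from degree `k - 1` to degree `k`: the alternating sum over the faces. For
`k = 0` this is the augmentation, which takes an integer to the constant function. -/
def augCoboundary (X : Type*) [TopologicalSpace X] (k : ℕ) :
    AugCochain X k →ₗ[ℤ] AugCochain X (k + 1) where
  toFun φ s := ∑ i : Fin (k + 1), (-1 : ℤ) ^ (i : ℕ) * φ (s.comp (coface k i))
  map_add' φ ψ := by
    funext s
    simp [mul_add, Finset.sum_add_distrib]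
  map_smul' c φ := by
    funext s
    simp [Finset.mul_sum, mul_left_comm]

theorem augCoboundary_comp (X : Type*) [TopologicalSpace X] (k : ℕ) :
    augCoboundary X (k + 1) ∘ₗ augCoboundary X k = 0 := by
  ext φ s
  simp only [augCoboundary, LinearMap.comp_apply, LinearMap.coe_mk, AddHom.coe_mk,
    LinearMap.zero_apply, Pi.zero_apply, Finset.mul_sum]
  rw [← Finset.sum_product', Finset.univ_product_univ]
  refine Finset.sum_involution (fun x _ => (x.1.succAbove x.2, x.2.predAbove x.1)) ?_ ?_ ?_ ?_
  · rintro ⟨j, i⟩ -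
    have hs : (s.comp (coface (k + 1) (j.succAbove i))).comp (coface k (i.predAbove j)) =
        (s.comp (coface (k + 1) j)).comp (coface k i) := by
      ext x
      simp only [ContinuousMap.comp_apply, coface, ContinuousMap.coe_mk,
        stdSimplex.map_comp_apply]
      congr 2
      funext l
      exact Fin.succAbove_succAbove_succAbove_predAbove j i l
    dsimp only
    rw [hs, ← mul_assoc, ← mul_assoc, ← pow_add, ← pow_add,
      Fin.neg_one_pow_succAbove_add_predAbove, neg_mul, add_neg_cancel]
  · rintro ⟨j, i⟩ - -
    simp [Fin.succAbove_ne]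
  · simp
  · rintro ⟨j, i⟩ -
    simp [Fin.succAbove_succAbove_predAbove, Fin.predAbove_predAbove_succAbove]

/-- The coboundaries of degree `k - 1`; in degree `-1` there are none but `0`. -/
def augCoboundaries (X : Type*) [TopologicalSpace X] : (k : ℕ) → Submodule ℤ (AugCochain X k)
  | 0 => ⊥
  | k + 1 => LinearMap.range (augCoboundary X k)

/-- The reduced singular cohomology group of `X` with integer coefficients in degree `k - 1`:
cocycles modulo coboundaries in the augmented singular cochain complex. In degrees below `-1` that
complex, and hence the reduced cohomology, is zero. -/
abbrev ReducedCohomology (X : Type*) [TopologicalSpace X] (k : ℕ) : Type _ :=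
  LinearMap.ker (augCoboundary X k) ⧸
    (augCoboundaries X k).submoduleOf (LinearMap.ker (augCoboundary X k))

/-- The reduced cohomology of `X` is torsion-free and concentrated in degree `m`. -/
def TorsionFreeConcentrated (X : Type*) [TopologicalSpace X] (m : ℤ) : Prop :=
  ∀ k : ℕ, IsAddTorsionFree (ReducedCohomology X k) ∧
    ((k : ℤ) - 1 ≠ m → Subsingleton (ReducedCohomology X k))

/-- The closed geometric simplex with vertex set `σ`, in barycentric coordinates; it is empty for
`σ = ∅`. -/
def closedSimplex {ι : Type*} [Fintype ι] (σ : Finset ι) : Set (ι → ℝ) :=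
  {x ∈ stdSimplex ℝ ι | ∀ i, i ∉ σ → x i = 0}

/-- The geometric realization of a finite simplicial complex. -/
def geomRealization {ι : Type*} [Fintype ι] (L : AbstractSimplicialComplex ι) : Set (ι → ℝ) :=
  ⋃ s ∈ L.faces, closedSimplex s

/-- The finite simplicial complex `L` is `PH^m`: for every closed simplex `σ` of `L`, including the
empty one, the reduced cohomology of the space `L - σ` is torsion-free and concentrated in
degree `m`. -/
def IsPH {ι : Type*} [Fintype ι] (L : AbstractSimplicialComplex ι) (m : ℤ) : Prop :=
  ∀ σ : Finset ι, σ = ∅ ∨ σ ∈ L.faces →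
    TorsionFreeConcentrated ↥(geomRealization L \ closedSimplex σ) m

/-- The vertex set of the simplex `g × Δ(U)`, where `U ⊆ V` and `g` is a `V`-tuple in
`{0, …, p}`: it depends only on `U` and on the restriction of `g` to `U`. -/
def tupleSimplex {p : ℕ} {V : Type*} (U : Finset V) (g : V → Fin (p + 1)) :
    Finset (V × Fin (p + 1)) :=
  U.map ⟨fun v => (v, g v), by
    intro v w h
    exact congrArg Prod.fst h⟩

theorem mem_tupleSimplex {p : ℕ} {V : Type*} (U : Finset V) (g : V → Fin (p + 1))
    (x : V × Fin (p + 1)) : x ∈ tupleSimplex U g ↔ x.1 ∈ U ∧ x.2 = g x.1 := by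
  obtain ⟨v, i⟩ := x
  rw [tupleSimplex, Finset.mem_map]
  constructor
  · rintro ⟨w, hw, h⟩
    obtain ⟨rfl, rfl⟩ := Prod.mk.inj h
    exact ⟨hw, rfl⟩
  · rintro ⟨hv, hi⟩
    exact ⟨v, hv, Prod.ext rfl hi.symm⟩

/-- A finite set of vertices of the join of copies, indexed by `V`, of the discrete set
`{0, …, p}` is of the form `g × Δ(U)` if and only if it has at most one vertex in each copy. -/
theorem exists_tupleSimplex_iff {p : ℕ} {V : Type*} (s : Finset (V × Fin (p + 1))) :
    (∃ U g, s = tupleSimplex U g) ↔ Set.InjOn Prod.fst (s : Set (V × Fin (p + 1))) := by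
  classical
  constructor
  · rintro ⟨U, g, rfl⟩ x hx y hy h
    rw [Finset.mem_coe, mem_tupleSimplex] at hx hy
    exact Prod.ext h (by rw [hx.2, hy.2, h])
  · intro h
    refine ⟨s.image Prod.fst, fun v => if hv : ∃ i, (v, i) ∈ s then hv.choose else 0, ?_⟩
    have key : ∀ v i, (v, i) ∈ s →
        (if hv : ∃ i, (v, i) ∈ s then hv.choose else 0) = i := by
      intro v i hi
      have hv : ∃ i, (v, i) ∈ s := ⟨i, hi⟩
      rw [dif_pos hv]
      exact congrArg Prod.snd (h hv.choose_spec hi rfl)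
    ext ⟨v, i⟩
    rw [mem_tupleSimplex, Finset.mem_image]
    constructor
    · intro hi
      exact ⟨⟨(v, i), hi, rfl⟩, (key v i hi).symm⟩
    · rintro ⟨⟨⟨w, j⟩, hj, rfl⟩, hi⟩
      dsimp only at hi hj ⊢
      rw [hi, key _ j hj]
      exact hj

/-- The complex `O(p, V)`, the join of copies, indexed by `V`, of the discrete set `{0, …, p}`: its
vertices are the pairs `(v, i)` and its simplices are the `g × Δ(U)` with `U` nonempty. -/
def joinComplex (p : ℕ) (V : Type*) : AbstractSimplicialComplex (V × Fin (p + 1)) where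
  faces := {s | s.Nonempty ∧ ∃ U g, s = tupleSimplex U g}
  isRelLowerSet_faces := by
    rintro s ⟨hs, h⟩
    refine ⟨hs, fun t hts ht => ⟨ht, ?_⟩⟩
    rw [exists_tupleSimplex_iff] at h ⊢
    exact h.mono (Finset.coe_subset.mpr hts)
  singleton_mem := by
    rintro ⟨v, i⟩
    exact ⟨Finset.singleton_nonempty _, {v}, fun _ => i, by
      ext ⟨w, j⟩
      simp [mem_tupleSimplex]⟩

end

/-! Without the normalisation that coordinates sum to 1, the complement of `σ` becomes `openStar ∅
σᶜ`: nonnegative functions with at most one nonzero coordinate in each copy and a positive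
coordinate outside `σ`. Division by the sum retracts this set onto the complement, and vanishing and
torsion-freeness of cohomology pass to retracts (`ConcentratedOn.torsionFreeConcentrated`).

The computation is `concentratedOn_openStar`, by induction on `A`, for the sets `openStar F A` in
which every copy meets exactly one of `F` and `A`, and `F` at most once. For `a ∈ A`, cover the set
by the open pieces "coordinate `a` is positive" and "some coordinate in `A.erase a` is positive".
The first piece contracts to the indicator of `insert a F`. The second is `openStar F (A.erase a)`.
On the intersection a positive coordinate `a` kills the rest of its copy, so `a` moves into `F` and
its whole copy leaves `A`. If `A` has another element in the copy of `a`, Mayer–Vietoris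
(`concentratedOn_of_cover`) gives the claim; if not, the whole set is contractible. The induction
also ends at `A = ∅`, where `F` meets every copy and the space is empty, with cohomology `ℤ` in
degree -1. Passing to an intersection lowers the degree by one and enlarges `F` by one, so the
degree is `|V| - |F| - 1`.

Mayer–Vietoris is carried out on singular cochains. Primitives that agree on the intersection are
glued; the remaining cocycle vanishes on all simplices subordinate to the cover, and iterated
barycentric subdivision makes it a coboundary (`coboundaryOn_of_eq_zero`). -/

noncomputable section

/-! ### Chains of tuples and their subdivision -/

/-- Integral chains on tuples of `k` points of `P`. -/
abbrev TupleChain (P : Type*) (k : ℕ) : Type _ := (Fin k → P) →₀ ℤ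

namespace TupleChain

variable {P Q : Type*}

/-- The alternating sum of the faces of a tuple. -/
def boundary (k : ℕ) : TupleChain P (k + 1) →ₗ[ℤ] TupleChain P k :=
  Finsupp.linearCombination ℤ fun w =>
    ∑ i : Fin (k + 1), (-1 : ℤ) ^ (i : ℕ) • Finsupp.single (w ∘ i.succAbove) (1 : ℤ)

theorem boundary_single {k : ℕ} (w : Fin (k + 1) → P) :
    boundary k (Finsupp.single w 1) =
      ∑ i : Fin (k + 1), (-1 : ℤ) ^ (i : ℕ) • Finsupp.single (w ∘ i.succAbove) (1 : ℤ) := by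
  simp [boundary]

theorem boundary_boundary {k : ℕ} (c : TupleChain P (k + 2)) :
    boundary k (boundary (k + 1) c) = 0 := by
  suffices h : boundary k ∘ₗ boundary (k + 1) = (0 : TupleChain P (k + 2) →ₗ[ℤ] _) from
    LinearMap.congr_fun h c
  refine Finsupp.lhom_ext' fun w => LinearMap.ext_ring ?_
  simp only [LinearMap.comp_apply, Finsupp.lsingle_apply, boundary_single, map_sum, map_smul,
    LinearMap.zero_apply, Finset.smul_sum, smul_smul]
  rw [← Finset.sum_product', Finset.univ_product_univ]
  -- Two entries can be deleted in either order; the involution exchanges the orders, which keeps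
  -- the tuple and flips the sign.
  refine Finset.sum_involution (fun x _ => (x.1.succAbove x.2, x.2.predAbove x.1)) ?_ ?_ ?_ ?_
  · rintro ⟨j, i⟩ -
    have hs : (w ∘ (j.succAbove i).succAbove) ∘ (i.predAbove j).succAbove =
        (w ∘ j.succAbove) ∘ i.succAbove := by
      funext l
      exact congrArg w (Fin.succAbove_succAbove_succAbove_predAbove j i l)
    dsimp only
    rw [hs, ← pow_add, ← pow_add, Fin.neg_one_pow_succAbove_add_predAbove, neg_smul,
      add_neg_cancel]
  · rintro ⟨j, i⟩ - -
    simp [Fin.succAbove_ne]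
  · simp
  · rintro ⟨j, i⟩ -
    simp [Fin.succAbove_succAbove_predAbove, Fin.predAbove_predAbove_succAbove]

/-- The cone with apex `b`. -/
def cone (b : P) (k : ℕ) : TupleChain P k →ₗ[ℤ] TupleChain P (k + 1) :=
  Finsupp.lmapDomain ℤ ℤ fun w => (Fin.cons b w : Fin (k + 1) → P)

theorem cone_single (b : P) {k : ℕ} (w : Fin k → P) :
    cone b k (Finsupp.single w 1) = Finsupp.single (Fin.cons b w : Fin (k + 1) → P) 1 := by
  simp [cone]

/-- The lowest degree is separate: an empty tuple has no boundary, so the correction term of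
`boundary_cone` is absent. -/
theorem boundary_cone_zero (b : P) (c : TupleChain P 0) : boundary 0 (cone b 0 c) = c := by
  suffices h : boundary 0 ∘ₗ cone b 0 = LinearMap.id from LinearMap.congr_fun h c
  refine Finsupp.lhom_ext' fun w => LinearMap.ext_ring ?_
  simp only [LinearMap.comp_apply, Finsupp.lsingle_apply, cone_single, boundary_single]
  rw [Fin.sum_univ_one, Fin.val_zero, pow_zero, one_smul, LinearMap.id_apply]
  congr 1

/-- Deleting the apex returns the base; deleting any other entry gives the cone over a face, with
its index, and hence its sign, shifted by one. -/
theorem boundary_cone (b : P) {k : ℕ} (c : TupleChain P (k + 1)) :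
    boundary (k + 1) (cone b (k + 1) c) = c - cone b k (boundary k c) := by
  suffices h : boundary (k + 1) ∘ₗ cone b (k + 1) =
      LinearMap.id - cone b k ∘ₗ boundary k from LinearMap.congr_fun h c
  refine Finsupp.lhom_ext' fun w => LinearMap.ext_ring ?_
  simp only [LinearMap.comp_apply, Finsupp.lsingle_apply, cone_single, boundary_single,
    LinearMap.sub_apply, LinearMap.id_apply, map_sum, map_smul]
  rw [Fin.sum_univ_succ, sub_eq_add_neg, ← Finset.sum_neg_distrib]
  congr 1
  · simp only [Fin.val_zero, pow_zero, one_smul]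
    congr 1
  · refine Finset.sum_congr rfl fun i _ => ?_
    rw [Fin.val_succ, pow_succ, mul_neg_one, neg_smul]
    congr 3
    funext j
    refine Fin.cases ?_ (fun j => ?_) j <;> simp

/-- The map induced by a map of point sets. -/
def map (f : P → Q) (k : ℕ) : TupleChain P k →ₗ[ℤ] TupleChain Q k :=
  Finsupp.lmapDomain ℤ ℤ fun w => f ∘ w

theorem map_single (f : P → Q) {k : ℕ} (w : Fin k → P) :
    map f k (Finsupp.single w 1) = Finsupp.single (f ∘ w) 1 := by
  simp [map]

theorem map_boundary (f : P → Q) {k : ℕ} (c : TupleChain P (k + 1)) :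
    map f k (boundary k c) = boundary k (map f (k + 1) c) := by
  suffices h : map f k ∘ₗ boundary k = boundary k ∘ₗ map f (k + 1) from LinearMap.congr_fun h c
  refine Finsupp.lhom_ext' fun w => LinearMap.ext_ring ?_
  simp only [LinearMap.comp_apply, Finsupp.lsingle_apply, map_single, boundary_single, map_sum,
    map_smul, Function.comp_assoc]

theorem map_cone (f : P → Q) (b : P) {k : ℕ} (c : TupleChain P k) :
    map f (k + 1) (cone b k c) = cone (f b) k (map f k c) := by
  suffices h : map f (k + 1) ∘ₗ cone b k = cone (f b) k ∘ₗ map f k from LinearMap.congr_fun h c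
  refine Finsupp.lhom_ext' fun w => LinearMap.ext_ring ?_
  simp only [LinearMap.comp_apply, Finsupp.lsingle_apply, cone_single, map_single]
  rw [Fin.comp_cons]

/-- The subdivision operator, which takes cones from the points chosen by `β`. -/
def subdiv (β : ∀ n, (Fin (n + 1) → P) → P) : ∀ k, TupleChain P k →ₗ[ℤ] TupleChain P k
  | 0 => LinearMap.id
  | k + 1 => Finsupp.linearCombination ℤ fun w =>
      cone (β k w) k (subdiv β k (boundary k (Finsupp.single w 1)))

/-- The chain homotopy between the identity and the subdivision operator. -/
def subdivHomotopy (β : ∀ n, (Fin (n + 1) → P) → P) :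
    ∀ k, TupleChain P k →ₗ[ℤ] TupleChain P (k + 1)
  | 0 => 0
  | k + 1 => Finsupp.linearCombination ℤ fun w =>
      cone (β k w) (k + 1) (Finsupp.single w 1 -
        subdivHomotopy β k (boundary k (Finsupp.single w 1)))

variable (β : ∀ n, (Fin (n + 1) → P) → P) (γ : ∀ n, (Fin (n + 1) → Q) → Q)

theorem subdiv_single {k : ℕ} (w : Fin (k + 1) → P) :
    subdiv β (k + 1) (Finsupp.single w 1) =
      cone (β k w) k (subdiv β k (boundary k (Finsupp.single w 1))) := by
  simp [subdiv]

theorem subdivHomotopy_single {k : ℕ} (w : Fin (k + 1) → P) :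
    subdivHomotopy β (k + 1) (Finsupp.single w 1) =
      cone (β k w) (k + 1) (Finsupp.single w 1 -
        subdivHomotopy β k (boundary k (Finsupp.single w 1))) := by
  simp [subdivHomotopy]

/-- In the boundary of the cone over the subdivided boundary, the correction term is a cone over the
subdivision of `∂∂ = 0`. -/
theorem boundary_subdiv : ∀ {k : ℕ} (c : TupleChain P (k + 1)),
    boundary k (subdiv β (k + 1) c) = subdiv β k (boundary k c) := by
  intro k
  induction k with
  | zero =>
    intro c
    suffices h : boundary 0 ∘ₗ subdiv β 1 = subdiv β 0 ∘ₗ boundary 0 from LinearMap.congr_fun h c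
    refine Finsupp.lhom_ext' fun w => LinearMap.ext_ring ?_
    simp only [LinearMap.comp_apply, Finsupp.lsingle_apply, subdiv_single, boundary_cone_zero]
  | succ k ih =>
    intro c
    suffices h : boundary (k + 1) ∘ₗ subdiv β (k + 2) = subdiv β (k + 1) ∘ₗ boundary (k + 1) from
      LinearMap.congr_fun h c
    refine Finsupp.lhom_ext' fun w => LinearMap.ext_ring ?_
    simp only [LinearMap.comp_apply, Finsupp.lsingle_apply, subdiv_single, boundary_cone, ih,
      boundary_boundary, map_zero, sub_zero]

theorem boundary_subdivHomotopy_zero (c : TupleChain P 0) :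
    boundary 0 (subdivHomotopy β 0 c) = c - subdiv β 0 c := by
  simp [subdivHomotopy, subdiv]

/-- The inductive step asks for the homotopy formula only on boundaries, where its last term
vanishes. In this form degree zero, whose formula has no such term, can start the induction. -/
theorem boundary_subdivHomotopy_of_boundary {k : ℕ}
    (hk : ∀ w : Fin (k + 1) → P,
      boundary k (subdivHomotopy β k (boundary k (Finsupp.single w 1))) =
        boundary k (Finsupp.single w 1) - subdiv β k (boundary k (Finsupp.single w 1)))
    (c : TupleChain P (k + 1)) :
    boundary (k + 1) (subdivHomotopy β (k + 1) c) =
      c - subdiv β (k + 1) c - subdivHomotopy β k (boundary k c) := by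
  suffices h : boundary (k + 1) ∘ₗ subdivHomotopy β (k + 1) =
      LinearMap.id - subdiv β (k + 1) - subdivHomotopy β k ∘ₗ boundary k from
    LinearMap.congr_fun h c
  refine Finsupp.lhom_ext' fun w => LinearMap.ext_ring ?_
  simp only [LinearMap.comp_apply, Finsupp.lsingle_apply, subdivHomotopy_single, boundary_cone,
    LinearMap.sub_apply, LinearMap.id_apply, map_sub, hk, subdiv_single]
  abel

theorem boundary_subdivHomotopy {k : ℕ} (c : TupleChain P (k + 1)) :
    boundary (k + 1) (subdivHomotopy β (k + 1) c) =
      c - subdiv β (k + 1) c - subdivHomotopy β k (boundary k c) := by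
  induction k with
  | zero =>
    refine boundary_subdivHomotopy_of_boundary β (fun w => ?_) c
    exact boundary_subdivHomotopy_zero β _
  | succ k ih =>
    refine boundary_subdivHomotopy_of_boundary β (fun w => ?_) c
    rw [ih, boundary_boundary, map_zero, sub_zero]

/-- Naturality under maps that respect the choice of apex. It is meant for coface maps, which are
affine and so preserve barycenters. -/
theorem map_subdiv {f : P → Q} (hf : ∀ n w, f (β n w) = γ n (f ∘ w)) : ∀ {k : ℕ}
    (c : TupleChain P k), map f k (subdiv β k c) = subdiv γ k (map f k c) := by
  intro k
  induction k with
  | zero => intro c; rfl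
  | succ k ih =>
    intro c
    suffices h : map f (k + 1) ∘ₗ subdiv β (k + 1) = subdiv γ (k + 1) ∘ₗ map f (k + 1) from
      LinearMap.congr_fun h c
    refine Finsupp.lhom_ext' fun w => LinearMap.ext_ring ?_
    simp only [LinearMap.comp_apply, Finsupp.lsingle_apply, subdiv_single, map_cone, ih,
      map_boundary, map_single, hf]

theorem map_subdivHomotopy {f : P → Q} (hf : ∀ n w, f (β n w) = γ n (f ∘ w)) : ∀ {k : ℕ}
    (c : TupleChain P k),
    map f (k + 1) (subdivHomotopy β k c) = subdivHomotopy γ k (map f k c) := by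
  intro k
  induction k with
  | zero => intro c; simp [subdivHomotopy]
  | succ k ih =>
    intro c
    suffices h : map f (k + 2) ∘ₗ subdivHomotopy β (k + 1) =
        subdivHomotopy γ (k + 1) ∘ₗ map f (k + 1) from LinearMap.congr_fun h c
    refine Finsupp.lhom_ext' fun w => LinearMap.ext_ring ?_
    simp only [LinearMap.comp_apply, Finsupp.lsingle_apply, subdivHomotopy_single, map_cone, ih,
      map_boundary, map_single, hf, map_sub]

/-- The `r`-fold subdivision operator. -/
def iterSubdiv (k : ℕ) : ℕ → TupleChain P k →ₗ[ℤ] TupleChain P k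
  | 0 => LinearMap.id
  | r + 1 => subdiv β k ∘ₗ iterSubdiv k r

/-- The chain homotopy between the identity and the `r`-fold subdivision operator. -/
def iterHomotopy (k : ℕ) : ℕ → TupleChain P k →ₗ[ℤ] TupleChain P (k + 1)
  | 0 => 0
  | r + 1 => iterHomotopy k r + subdivHomotopy β k ∘ₗ iterSubdiv β k r

theorem boundary_iterSubdiv {k : ℕ} (r : ℕ) (c : TupleChain P (k + 1)) :
    boundary k (iterSubdiv β (k + 1) r c) = iterSubdiv β k r (boundary k c) := by
  induction r with
  | zero => rfl
  | succ r ih => simp only [iterSubdiv, LinearMap.comp_apply, boundary_subdiv, ih]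

/-- The homotopies applied to successive subdivisions add up, and the differences of consecutive
subdivisions telescope. -/
theorem boundary_iterHomotopy {k : ℕ} (r : ℕ) (c : TupleChain P (k + 1)) :
    boundary (k + 1) (iterHomotopy β (k + 1) r c) =
      c - iterSubdiv β (k + 1) r c - iterHomotopy β k r (boundary k c) := by
  induction r with
  | zero => simp [iterHomotopy, iterSubdiv]
  | succ r ih =>
    simp only [iterHomotopy, iterSubdiv, LinearMap.comp_apply, LinearMap.add_apply, map_add, ih,
      boundary_subdivHomotopy, boundary_iterSubdiv]
    abel

theorem map_iterSubdiv {f : P → Q} (hf : ∀ n w, f (β n w) = γ n (f ∘ w)) {k : ℕ} (r : ℕ)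
    (c : TupleChain P k) : map f k (iterSubdiv β k r c) = iterSubdiv γ k r (map f k c) := by
  induction r with
  | zero => rfl
  | succ r ih => simp only [iterSubdiv, LinearMap.comp_apply, map_subdiv β γ hf, ih]

theorem map_iterHomotopy {f : P → Q} (hf : ∀ n w, f (β n w) = γ n (f ∘ w)) {k : ℕ} (r : ℕ)
    (c : TupleChain P k) :
    map f (k + 1) (iterHomotopy β k r c) = iterHomotopy γ k r (map f k c) := by
  induction r with
  | zero => simp [iterHomotopy]
  | succ r ih =>
    simp only [iterHomotopy, LinearMap.comp_apply, LinearMap.add_apply, map_add, ih,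
      map_subdivHomotopy β γ hf, map_iterSubdiv β γ hf]

end TupleChain

/-! ### The mesh of the subdivision -/

namespace TupleChain

/-- A linear map that takes the tuples in `S` to chains supported in `T` takes all chains supported
in `S` to chains supported in `T`. -/
theorem map_mem_supported {α β : Type*} {S : Set α} {T : Set β} (L : (α →₀ ℤ) →ₗ[ℤ] (β →₀ ℤ))
    (h : ∀ w ∈ S, L (Finsupp.single w 1) ∈ Finsupp.supported ℤ ℤ T) {c : α →₀ ℤ}
    (hc : c ∈ Finsupp.supported ℤ ℤ S) : L c ∈ Finsupp.supported ℤ ℤ T := by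
  rw [Finsupp.supported_eq_span_single] at hc
  have : Submodule.span ℤ ((fun i => Finsupp.single i (1 : ℤ)) '' S) ≤
      (Finsupp.supported ℤ ℤ T).comap L := by
    rw [Submodule.span_le]
    rintro _ ⟨w, hw, rfl⟩
    exact h w hw
  exact this hc

theorem cone_mem_supported {P : Type*} {k : ℕ} (b : P) {S : Set (Fin k → P)}
    {T : Set (Fin (k + 1) → P)} (h : ∀ w ∈ S, (Fin.cons b w : Fin (k + 1) → P) ∈ T)
    {c : TupleChain P k} (hc : c ∈ Finsupp.supported ℤ ℤ S) :
    cone b k c ∈ Finsupp.supported ℤ ℤ T := by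
  refine map_mem_supported _ (fun w hw => ?_) hc
  rw [cone_single]
  exact Finsupp.single_mem_supported ℤ _ (h w hw)

theorem map_boundary_single_mem {P : Type*} {β : Type*} {k : ℕ} {T : Set β}
    (L : TupleChain P k →ₗ[ℤ] (β →₀ ℤ)) (w : Fin (k + 1) → P)
    (h : ∀ i : Fin (k + 1), L (Finsupp.single (w ∘ i.succAbove) 1) ∈ Finsupp.supported ℤ ℤ T) :
    L (boundary k (Finsupp.single w 1)) ∈ Finsupp.supported ℤ ℤ T := by
  simp only [boundary_single, map_sum, map_smul]
  exact Submodule.sum_mem _ fun i _ => Submodule.smul_mem _ _ (h i)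

variable {P : Type*} [PseudoMetricSpace P]

/-- Every closed ball that contains the points of `w` contains those of `w'`. -/
def InHull {k l : ℕ} (w : Fin k → P) (w' : Fin l → P) : Prop :=
  ∀ q ρ, (∀ j, dist (w j) q ≤ ρ) → ∀ i, dist (w' i) q ≤ ρ

/-- The points of `w` have distance at most `d` from each other. -/
def MeshLE {k : ℕ} (w : Fin k → P) (d : ℝ) : Prop :=
  ∀ i j, dist (w i) (w j) ≤ d

/-- Closed balls stand in for convex hulls. Balls centred at points of `w` contain `w'`; hence balls
of radius `d` centred at points of `w'` contain `w`, and therefore `w'`. -/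
theorem InHull.meshLE {k l : ℕ} {w : Fin k → P} {w' : Fin l → P} (h : InHull w w') {d : ℝ}
    (hd : MeshLE w d) : MeshLE w' d := fun i j =>
  h _ _ (fun a => by
    rw [dist_comm]
    exact h _ _ (fun b => hd b a) j) i

theorem InHull.cons {k l : ℕ} {w : Fin k → P} {w' : Fin l → P} (h : InHull w w') {b : P}
    (hb : ∀ q ρ, (∀ j, dist (w j) q ≤ ρ) → dist b q ≤ ρ) :
    InHull w (Fin.cons b w' : Fin (l + 1) → P) := fun q ρ hq i => by
  refine Fin.cases ?_ (fun i => ?_) i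
  · exact hb q ρ hq
  · exact h q ρ hq i

theorem InHull.of_face {k l : ℕ} {w : Fin (k + 1) → P} {i : Fin (k + 1)} {w' : Fin l → P}
    (h : InHull (w ∘ i.succAbove) w') : InHull w w' :=
  fun q ρ hq => h q ρ fun _ => hq _

variable {β : ∀ n, (Fin (n + 1) → P) → P}
  (hβ : ∀ n (w : Fin (n + 1) → P) q ρ, (∀ j, dist (w j) q ≤ ρ) → dist (β n w) q ≤ ρ)

include hβ

theorem subdivHomotopy_mem_inHull {k : ℕ} (w : Fin k → P) :
    subdivHomotopy β k (Finsupp.single w 1) ∈ Finsupp.supported ℤ ℤ {w' | InHull w w'} := by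
  induction k with
  | zero => simp [subdivHomotopy]
  | succ k ih =>
    rw [subdivHomotopy_single]
    refine cone_mem_supported _ (S := {w' | InHull w w'})
      (fun w' hw' => InHull.cons hw' (hβ k w)) (Submodule.sub_mem _ ?_ ?_)
    · exact Finsupp.single_mem_supported ℤ _ fun q ρ h => h
    · exact map_boundary_single_mem _ _ fun i =>
        Finsupp.supported_mono (fun w' hw' => InHull.of_face hw') (ih _)

/-- A tuple in the subdivision is an apex followed by a tuple from a subdivided face. Induction
bounds the distances within the face; those to the apex are bounded because the face lies in the
hull of `w`. -/
theorem subdiv_mem_meshLE {K : ℕ} {θ : ℝ} (hθ : 0 ≤ θ)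
    (hβθ : ∀ n ≤ K, ∀ (w : Fin (n + 1) → P) d, MeshLE w d → ∀ j, dist (β n w) (w j) ≤ θ * d)
    {d : ℝ} (hd : 0 ≤ d) {k : ℕ} (hk : k ≤ K + 1) (w : Fin k → P) (hw : MeshLE w d) :
    subdiv β k (Finsupp.single w 1) ∈
      Finsupp.supported ℤ ℤ {w' | InHull w w' ∧ MeshLE w' (θ * d)} := by
  induction k with
  | zero =>
    exact Finsupp.single_mem_supported ℤ _ ⟨fun q ρ h => h, fun i => i.elim0⟩
  | succ k ih =>
    rw [subdiv_single]
    refine cone_mem_supported _ (S := {w' | InHull w w' ∧ MeshLE w' (θ * d)}) ?_ ?_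
    · intro w' hw'
      refine ⟨InHull.cons hw'.1 (hβ k w), ?_⟩
      -- The ball of radius `θ * d` about the apex contains `w`, hence also `w'`.
      have hb : ∀ j, dist (w' j) (β k w) ≤ θ * d := hw'.1 _ _ fun j => by
        rw [dist_comm]
        exact hβθ k (by omega) w d hw j
      intro i j
      refine Fin.cases ?_ (fun i => ?_) i <;> refine Fin.cases ?_ (fun j => ?_) j
      · simpa using mul_nonneg hθ hd
      · simpa [dist_comm] using hb j
      · simpa using hb i
      · simpa using hw'.2 i j
    · exact map_boundary_single_mem _ _ fun i =>
        Finsupp.supported_mono (fun w' hw' => And.intro (InHull.of_face hw'.1) hw'.2)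
          (ih (by omega) (w ∘ i.succAbove) fun a b => hw _ _)

theorem iterSubdiv_mem_meshLE {K : ℕ} {θ : ℝ} (hθ : 0 ≤ θ)
    (hβθ : ∀ n ≤ K, ∀ (w : Fin (n + 1) → P) d, MeshLE w d → ∀ j, dist (β n w) (w j) ≤ θ * d)
    {d : ℝ} (hd : 0 ≤ d) {k : ℕ} (hk : k ≤ K + 1) (w : Fin k → P) (hw : MeshLE w d) (r : ℕ) :
    iterSubdiv β k r (Finsupp.single w 1) ∈
      Finsupp.supported ℤ ℤ {w' | MeshLE w' (θ ^ r * d)} := by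
  induction r with
  | zero => exact Finsupp.single_mem_supported ℤ _ (by simpa using hw)
  | succ r ih =>
    refine map_mem_supported (subdiv β k) (fun w' hw' => ?_) ih
    refine Finsupp.supported_mono (fun w'' h => ?_)
      (subdiv_mem_meshLE hβ hθ hβθ (mul_nonneg (pow_nonneg hθ r) hd) hk w' hw')
    have := h.2
    rwa [← mul_assoc, ← pow_succ'] at this

end TupleChain

/-! ### Affine simplices -/

theorem coface_apply_self {k : ℕ} (i : Fin (k + 1)) (y : stdSimplex ℝ (Fin k)) :
    (coface k i y).1 i = 0 := by
  change FunOnFinite.linearMap ℝ ℝ i.succAbove y.1 _ = _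
  rw [FunOnFinite.linearMap_apply_apply]
  refine Finset.sum_eq_zero fun j hj => ?_
  simp [Fin.succAbove_ne] at hj

theorem coface_apply_succAbove {k : ℕ} (i : Fin (k + 1)) (y : stdSimplex ℝ (Fin k)) (j : Fin k) :
    (coface k i y).1 (i.succAbove j) = y.1 j := by
  change FunOnFinite.linearMap ℝ ℝ i.succAbove y.1 _ = _
  rw [FunOnFinite.linearMap_apply_apply]
  rw [Finset.sum_eq_single j]
  · intro b hb hne
    simp [hne] at hb
  · simp

/-- The affine map between standard simplices with prescribed vertices. -/
def affineSimplex {k m : ℕ} (w : Fin k → stdSimplex ℝ (Fin m)) :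
    C(stdSimplex ℝ (Fin k), stdSimplex ℝ (Fin m)) where
  toFun y := ⟨∑ j, y.1 j • (w j).1,
    (convex_stdSimplex ℝ (Fin m)).sum_mem (fun j _ => y.2.1 j) y.2.2 fun j _ => (w j).2⟩
  continuous_toFun := by
    refine Continuous.subtype_mk ?_ _
    refine continuous_finsetSum _ fun j _ => Continuous.smul (f := fun y : stdSimplex ℝ (Fin k) => y.1 j) ?_ continuous_const
    exact (continuous_apply j).comp continuous_subtype_val

theorem affineSimplex_coe {k m : ℕ} (w : Fin k → stdSimplex ℝ (Fin m))
    (y : stdSimplex ℝ (Fin k)) :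
    (affineSimplex w y).1 = ∑ j, y.1 j • (w j).1 := rfl

theorem affineSimplex_comp_coface {k m : ℕ} (w : Fin (k + 1) → stdSimplex ℝ (Fin m))
    (i : Fin (k + 1)) : (affineSimplex w).comp (coface k i) = affineSimplex (w ∘ i.succAbove) := by
  refine ContinuousMap.ext fun y => Subtype.ext ?_
  rw [ContinuousMap.comp_apply, affineSimplex_coe, affineSimplex_coe, Fin.sum_univ_succAbove _ i]
  have h0 : (coface k i y).1 i = 0 := coface_apply_self i y
  have h1 : ∀ j, (coface k i y).1 (i.succAbove j) = y.1 j := coface_apply_succAbove i y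
  simp only [h0, h1, zero_smul, zero_add, Function.comp_apply]

theorem coface_affineSimplex {k m : ℕ} (w : Fin k → stdSimplex ℝ (Fin m)) (i : Fin (m + 1))
    (y : stdSimplex ℝ (Fin k)) :
    coface m i (affineSimplex w y) = affineSimplex (coface m i ∘ w) y := by
  refine Subtype.ext (funext fun l => ?_)
  rw [affineSimplex_coe, Finset.sum_apply]
  simp only [Pi.smul_apply, Function.comp_apply]
  rcases Fin.eq_self_or_eq_succAbove i l with rfl | ⟨l, rfl⟩
  · rw [coface_apply_self]
    simp [coface_apply_self]
  · simp only [coface_apply_succAbove]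
    rw [affineSimplex_coe, Finset.sum_apply]
    simp

/-- The tuple of vertices of a standard simplex. -/
def stdVertices (m : ℕ) : Fin m → stdSimplex ℝ (Fin m) := stdSimplex.vertex

theorem affineSimplex_stdVertices (m : ℕ) :
    affineSimplex (stdVertices m) = ContinuousMap.id _ := by
  refine ContinuousMap.ext fun y => Subtype.ext (funext fun l => ?_)
  rw [affineSimplex_coe, Finset.sum_apply]
  simp [stdVertices, Pi.single_apply]

theorem stdVertices_comp_succAbove (m : ℕ) (i : Fin (m + 1)) :
    stdVertices (m + 1) ∘ i.succAbove = coface m i ∘ stdVertices m := by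
  funext j
  simp [stdVertices, coface]

/-- Balls are convex. This is the hull condition that the mesh estimates impose on the choice of
apex. -/
theorem dist_affineSimplex_le {k m : ℕ} (w : Fin k → stdSimplex ℝ (Fin m))
    (y : stdSimplex ℝ (Fin k)) (q : stdSimplex ℝ (Fin m)) (ρ : ℝ)
    (h : ∀ j, dist (w j) q ≤ ρ) : dist (affineSimplex w y) q ≤ ρ := by
  have := (convex_closedBall q.1 ρ).sum_mem (t := Finset.univ) (w := y)
    (z := fun j => (w j).1) (fun j _ => y.2.1 j) y.2.2 fun j _ => h j
  exact this

/-- The barycenter of a nonempty tuple. -/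
def tupleBarycenter (m n : ℕ) (w : Fin (n + 1) → stdSimplex ℝ (Fin m)) : stdSimplex ℝ (Fin m) :=
  affineSimplex w stdSimplex.barycenter

theorem coface_tupleBarycenter {m : ℕ} (i : Fin (m + 1)) (n : ℕ)
    (w : Fin (n + 1) → stdSimplex ℝ (Fin m)) :
    coface m i (tupleBarycenter m n w) = tupleBarycenter (m + 1) n (coface m i ∘ w) :=
  coface_affineSimplex w i _

/-- The difference is the average of the `n + 1` vectors from `w j` to the vertices, one of which is
zero. -/
theorem dist_tupleBarycenter_le {m n : ℕ} (w : Fin (n + 1) → stdSimplex ℝ (Fin m)) {d : ℝ}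
    (hd : TupleChain.MeshLE w d) (j : Fin (n + 1)) :
    dist (tupleBarycenter m n w) (w j) ≤ n / (n + 1) * d := by
  have hn : (0 : ℝ) < n + 1 := by positivity
  have h1 : (tupleBarycenter m n w).1 - (w j).1 =
      ((n : ℝ) + 1)⁻¹ • ∑ i, ((w i).1 - (w j).1) := by
    rw [tupleBarycenter, affineSimplex_coe, Finset.sum_sub_distrib, smul_sub, Finset.smul_sum]
    congr 1
    · refine Finset.sum_congr rfl fun i _ => ?_
      congr 1
      change (stdSimplex.barycenter : stdSimplex ℝ (Fin (n + 1))).val i = _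
      rw [stdSimplex.barycenter_apply]
      simp
    · rw [Finset.sum_const, Finset.card_univ, Fintype.card_fin, ← Nat.cast_smul_eq_nsmul ℝ,
        smul_smul, Nat.cast_add, Nat.cast_one, inv_mul_cancel₀ hn.ne', one_smul]
  rw [Subtype.dist_eq, dist_eq_norm, h1, norm_smul, Fin.sum_univ_succAbove _ j, sub_self, zero_add,
    Real.norm_of_nonneg (by positivity)]
  have h2 : ‖∑ i : Fin n, ((w (j.succAbove i)).1 - (w j).1)‖ ≤ n * d := by
    refine (norm_sum_le _ _).trans ?_
    refine (Finset.sum_le_card_nsmul _ _ d fun i _ => ?_).trans (by simp)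
    rw [← dist_eq_norm]
    exact hd _ _
  calc _ ≤ ((n : ℝ) + 1)⁻¹ * (n * d) := by gcongr
    _ = _ := by ring

/-! ### Cochains on subsets and the small simplices theorem -/

instance isEmpty_stdSimplex_fin_zero : IsEmpty (stdSimplex ℝ (Fin 0)) := by
  rw [stdSimplex_of_isEmpty_index]
  infer_instance

section Small

variable {E : Type*} [TopologicalSpace E]

/-- The singular simplex `s` lies in `Y`. -/
def LiesIn (Y : Set E) {k : ℕ} (s : C(stdSimplex ℝ (Fin k), E)) : Prop := ∀ y, s y ∈ Y

theorem LiesIn.mono {Y Z : Set E} (h : Y ⊆ Z) {k : ℕ} {s : C(stdSimplex ℝ (Fin k), E)}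
    (hs : LiesIn Y s) : LiesIn Z s := fun y => h (hs y)

theorem LiesIn.comp {Y : Set E} {k l : ℕ} {s : C(stdSimplex ℝ (Fin k), E)} (hs : LiesIn Y s)
    (f : C(stdSimplex ℝ (Fin l), stdSimplex ℝ (Fin k))) : LiesIn Y (s.comp f) := fun y => hs (f y)

/-- The cochain `φ` restricts to a cocycle on `Y`. -/
def CocycleOn (Y : Set E) (k : ℕ) (φ : AugCochain E k) : Prop :=
  ∀ s, LiesIn Y s → augCoboundary E k φ s = 0

/-- The cochain `φ` restricts to a coboundary on `Y`. -/
def CoboundaryOn (Y : Set E) : (k : ℕ) → AugCochain E k → Prop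
  | 0, φ => ∀ s, φ s = 0
  | k + 1, φ => ∃ ψ, ∀ s, LiesIn Y s → augCoboundary E k ψ s = φ s

theorem augCoboundary_apply {k : ℕ} (φ : AugCochain E k) (s : C(stdSimplex ℝ (Fin (k + 1)), E)) :
    augCoboundary E k φ s = ∑ i : Fin (k + 1), (-1 : ℤ) ^ (i : ℕ) * φ (s.comp (coface k i)) := rfl

/-- The value of a cochain on the image of an affine chain under a singular simplex. -/
def evalChain {m k : ℕ} (φ : AugCochain E k) (s : C(stdSimplex ℝ (Fin m), E)) :
    TupleChain (stdSimplex ℝ (Fin m)) k →ₗ[ℤ] ℤ :=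
  Finsupp.linearCombination ℤ fun w => φ (s.comp (affineSimplex w))

theorem evalChain_single {m k : ℕ} (φ : AugCochain E k) (s : C(stdSimplex ℝ (Fin m), E))
    (w : Fin k → stdSimplex ℝ (Fin m)) :
    evalChain φ s (Finsupp.single w 1) = φ (s.comp (affineSimplex w)) := by
  simp [evalChain]

theorem evalChain_boundary {m k : ℕ} (φ : AugCochain E k) (s : C(stdSimplex ℝ (Fin m), E))
    (c : TupleChain (stdSimplex ℝ (Fin m)) (k + 1)) :
    evalChain φ s (TupleChain.boundary k c) = evalChain (augCoboundary E k φ) s c := by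
  suffices h : evalChain φ s ∘ₗ TupleChain.boundary k = evalChain (augCoboundary E k φ) s from
    LinearMap.congr_fun h c
  refine Finsupp.lhom_ext' fun w => LinearMap.ext_ring ?_
  simp only [LinearMap.comp_apply, Finsupp.lsingle_apply, TupleChain.boundary_single, map_sum,
    map_smul, evalChain_single, augCoboundary_apply, ContinuousMap.comp_assoc,
    affineSimplex_comp_coface, smul_eq_mul]

theorem evalChain_map_coface {m k : ℕ} (φ : AugCochain E k)
    (s : C(stdSimplex ℝ (Fin (m + 1)), E)) (i : Fin (m + 1))
    (c : TupleChain (stdSimplex ℝ (Fin m)) k) :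
    evalChain φ s (TupleChain.map (coface m i) k c) = evalChain φ (s.comp (coface m i)) c := by
  suffices h : evalChain φ s ∘ₗ TupleChain.map (coface m i) k = evalChain φ (s.comp (coface m i))
    from LinearMap.congr_fun h c
  refine Finsupp.lhom_ext' fun w => LinearMap.ext_ring ?_
  simp only [LinearMap.comp_apply, Finsupp.lsingle_apply, TupleChain.map_single, evalChain_single]
  congr 1
  ext y
  simp only [ContinuousMap.comp_apply, coface_affineSimplex]

theorem evalChain_eq_zero {m k : ℕ} {φ : AugCochain E k} {s : C(stdSimplex ℝ (Fin m), E)}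
    {S : Set (Fin k → stdSimplex ℝ (Fin m))} (h : ∀ w ∈ S, φ (s.comp (affineSimplex w)) = 0)
    {c : TupleChain (stdSimplex ℝ (Fin m)) k} (hc : c ∈ Finsupp.supported ℤ ℤ S) :
    evalChain φ s c = 0 := by
  rw [evalChain, Finsupp.linearCombination_apply]
  refine Finset.sum_eq_zero fun w hw => ?_
  simp only [h w (hc hw), smul_zero]

/-- Affine simplices of small mesh are mapped into one of the sets of an open cover. -/
theorem exists_mesh_liesIn {Y O₁ O₂ : Set E} (h₁ : IsOpen O₁) (h₂ : IsOpen O₂) (hY : Y ⊆ O₁ ∪ O₂)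
    {m : ℕ} {s : C(stdSimplex ℝ (Fin m), E)} (hs : LiesIn Y s) :
    ∃ δ > 0, ∀ (l : ℕ) (w : Fin l → stdSimplex ℝ (Fin m)), TupleChain.MeshLE w δ →
      LiesIn (Y ∩ O₁) (s.comp (affineSimplex w)) ∨
        LiesIn (Y ∩ O₂) (s.comp (affineSimplex w)) := by
  obtain ⟨δ, hδ, h⟩ := lebesgue_number_lemma_of_metric (s := Set.univ)
    (c := fun b : Bool => s ⁻¹' (cond b O₁ O₂)) isCompact_univ
    (by rintro (_ | _) <;> [exact h₂.preimage s.continuous; exact h₁.preimage s.continuous])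
    (by
      intro y _
      rcases hY (hs y) with hy | hy
      · exact Set.mem_iUnion.mpr ⟨true, hy⟩
      · exact Set.mem_iUnion.mpr ⟨false, hy⟩)
  -- Mesh at most `δ / 2` puts the whole affine simplex in the open `δ`-ball about its vertex `0`.
  refine ⟨δ / 2, half_pos hδ, fun l w hw => ?_⟩
  cases l with
  | zero => exact Or.inl fun y => isEmptyElim y
  | succ l =>
    have key : ∀ y, affineSimplex w y ∈ Metric.ball (w 0) δ := fun y =>
      lt_of_le_of_lt (dist_affineSimplex_le w y (w 0) _ fun j => hw j 0) (half_lt_self hδ)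
    obtain ⟨b, hb⟩ := h (w 0) trivial
    cases b
    · exact Or.inr fun y => ⟨hs _, hb (key y)⟩
    · exact Or.inl fun y => ⟨hs _, hb (key y)⟩

/-- The chain of the iterated barycentric subdivision of the standard simplex. -/
abbrev stdSubdiv (m r : ℕ) : TupleChain (stdSimplex ℝ (Fin m)) m :=
  TupleChain.iterSubdiv (tupleBarycenter m) m r (Finsupp.single (stdVertices m) 1)

/-- The chain of the homotopy from the standard simplex to its iterated subdivision. -/
abbrev stdHomotopy (m r : ℕ) : TupleChain (stdSimplex ℝ (Fin m)) (m + 1) :=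
  TupleChain.iterHomotopy (tupleBarycenter m) m r (Finsupp.single (stdVertices m) 1)

/-- Each subdivision multiplies the mesh by at most a constant less than 1 that depends only on the
dimension. -/
theorem exists_stdSubdiv_mem_meshLE (m : ℕ) {δ : ℝ} (hδ : 0 < δ) :
    ∃ N, ∀ r ≥ N, stdSubdiv m r ∈ Finsupp.supported ℤ ℤ {w | TupleChain.MeshLE w δ} := by
  -- Tuples of at most `m` points would allow `(m - 1) / m`; the larger ratio avoids the
  -- subtraction.
  set θ : ℝ := m / (m + 1) with hθ
  have h0 : 0 ≤ θ := by positivity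
  have h1 : θ < 1 := by
    rw [hθ, div_lt_one (by positivity)]
    exact lt_add_one _
  have hd : TupleChain.MeshLE (stdVertices m) (Metric.diam (Set.univ : Set (stdSimplex ℝ (Fin m)))) :=
    fun i j => Metric.dist_le_diam_of_mem isCompact_univ.isBounded trivial trivial
  have hlim := (tendsto_pow_atTop_nhds_zero_of_lt_one h0 h1).mul_const
    (Metric.diam (Set.univ : Set (stdSimplex ℝ (Fin m))))
  rw [zero_mul] at hlim
  obtain ⟨N, hN⟩ := Filter.eventually_atTop.mp (hlim.eventually (ge_mem_nhds hδ))
  refine ⟨N, fun r hr => Finsupp.supported_mono (fun w hw i j => (hw i j).trans (hN r hr))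
    (TupleChain.iterSubdiv_mem_meshLE (K := m) (θ := θ) ?_ h0 ?_ Metric.diam_nonneg (by omega) _ hd
      r)⟩
  · intro n w q ρ h
    exact dist_affineSimplex_le w _ q ρ h
  · intro n hn w d hw j
    refine (dist_tupleBarycenter_le w hw j).trans ?_
    have hd : 0 ≤ d := dist_nonneg.trans (hw j j)
    have hnm : (n : ℝ) ≤ m := by exact_mod_cast hn
    refine mul_le_mul_of_nonneg_right ?_ hd
    rw [hθ, div_le_div_iff₀ (by positivity) (by positivity)]
    linarith

/-- A cocycle that vanishes on the simplices subordinate to an open cover is a coboundary. -/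
theorem coboundaryOn_of_eq_zero {Y O₁ O₂ : Set E} (h₁ : IsOpen O₁) (h₂ : IsOpen O₂)
    (hY : Y ⊆ O₁ ∪ O₂) {k : ℕ} {φ : AugCochain E k} (hφ : CocycleOn Y k φ)
    (hφ₁ : ∀ s, LiesIn (Y ∩ O₁) s → φ s = 0) (hφ₂ : ∀ s, LiesIn (Y ∩ O₂) s → φ s = 0) :
    CoboundaryOn Y k φ := by
  classical
  cases k with
  | zero => exact fun s => hφ₁ s fun y => isEmptyElim y
  | succ k =>
    have small : ∀ {m : ℕ} (s : C(stdSimplex ℝ (Fin m), E)), LiesIn Y s → ∃ N, ∃ δ > 0,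
        (∀ (w : Fin (k + 1) → stdSimplex ℝ (Fin m)), TupleChain.MeshLE w δ →
          φ (s.comp (affineSimplex w)) = 0) ∧
        ∀ r ≥ N, stdSubdiv m r ∈ Finsupp.supported ℤ ℤ {w | TupleChain.MeshLE w δ} := by
      intro m s hs
      obtain ⟨δ, hδ, h⟩ := exists_mesh_liesIn h₁ h₂ hY hs
      obtain ⟨N, hN⟩ := exists_stdSubdiv_mem_meshLE m hδ
      exact ⟨N, δ, hδ, fun w hw => (h _ w hw).elim (hφ₁ _) (hφ₂ _), hN⟩
    -- Beyond a certain `r`, each further term of the homotopy is supported on small simplices,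
    -- where `φ` vanishes. The number of subdivisions needed depends on `s`, so the primitive uses
    -- the eventual value.
    have stable : ∀ s : C(stdSimplex ℝ (Fin k), E), LiesIn Y s → ∃ N, ∀ r ≥ N,
        evalChain φ s (stdHomotopy k r) = evalChain φ s (stdHomotopy k N) := by
      intro s hs
      obtain ⟨N, δ, hδ, hz, hN⟩ := small s hs
      refine ⟨N, fun r hr => ?_⟩
      induction r, hr using Nat.le_induction with
      | base => rfl
      | succ r hr ih =>
        rw [← ih]
        simp only [stdHomotopy, TupleChain.iterHomotopy, LinearMap.add_apply,
          LinearMap.comp_apply, map_add]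
        rw [add_eq_left]
        refine evalChain_eq_zero (S := {w | TupleChain.MeshLE w δ}) hz
          (TupleChain.map_mem_supported _ (fun w hw => ?_) (hN r hr))
        exact Finsupp.supported_mono (fun w' hw' => TupleChain.InHull.meshLE hw' hw)
          (TupleChain.subdivHomotopy_mem_inHull
            (fun n w q ρ h => dist_affineSimplex_le w _ q ρ h) w)
    choose N hN using stable
    refine ⟨fun s => if hs : LiesIn Y s then evalChain φ s (stdHomotopy k (N s hs)) else 0,
      fun s hs => ?_⟩
    obtain ⟨M, δ, hδ, hz, hM⟩ := small s hs
    -- One `r` that makes the subdivision of `s` small and lies in the stable range of every face of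
    -- `s`.
    set r := max M (Finset.univ.sup fun i => N (s.comp (coface k i)) (hs.comp _)) with hr
    have hface : ∀ i : Fin (k + 1), evalChain φ s (TupleChain.iterHomotopy (tupleBarycenter (k + 1))
        k r (Finsupp.single (stdVertices (k + 1) ∘ i.succAbove) 1)) =
        evalChain φ (s.comp (coface k i)) (stdHomotopy k (N _ (hs.comp (coface k i)))) := by
      intro i
      rw [← hN _ (hs.comp (coface k i)) r, ← evalChain_map_coface, stdHomotopy,
        TupleChain.map_iterHomotopy _ (tupleBarycenter (k + 1)) (coface_tupleBarycenter i),
        TupleChain.map_single, stdVertices_comp_succAbove]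
      exact le_max_of_le_right
        (Finset.le_sup (f := fun i => N (s.comp (coface k i)) (hs.comp _)) (Finset.mem_univ i))
    -- Expanding this boundary by the homotopy formula gives three terms. The subdivided simplex
    -- contributes zero, so `φ s` equals the value on the homotopy of the faces, which is the
    -- coboundary of the chosen cochain.
    have hcoc : evalChain φ s (TupleChain.boundary (k + 1) (stdHomotopy (k + 1) r)) = 0 := by
      rw [evalChain_boundary]
      exact evalChain_eq_zero (S := Set.univ) (fun w _ => hφ _ (hs.comp _)) (by simp)
    rw [stdHomotopy, TupleChain.boundary_iterHomotopy, map_sub, map_sub, evalChain_single,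
      affineSimplex_stdVertices, ContinuousMap.comp_id,
      evalChain_eq_zero (S := {w | TupleChain.MeshLE w δ}) hz (hM r (le_max_left _ _)), sub_zero,
      sub_eq_zero, TupleChain.boundary_single] at hcoc
    simp only [map_sum, map_smul, hface, smul_eq_mul] at hcoc
    rw [hcoc, augCoboundary_apply]
    exact Finset.sum_congr rfl fun i _ => by rw [dif_pos (hs.comp _)]

end Small

/-! ### Contractible sets -/

section Cone

open Topology

variable {E : Type*} [TopologicalSpace E]

/-- Every cocycle of degree `k - 1` on `Y` is a coboundary. -/
def AcyclicOn (Y : Set E) (k : ℕ) : Prop :=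
  ∀ φ : AugCochain E k, CocycleOn Y k φ → CoboundaryOn Y k φ

/-- The projection of a point of a standard simplex, other than the vertex `0`, from the vertex `0`
to the opposite face. -/
def projectFace {k : ℕ} (u : stdSimplex ℝ (Fin (k + 1))) (h : u.1 0 ≠ 1) : stdSimplex ℝ (Fin k) :=
  ⟨fun i => u.1 i.succ / (1 - u.1 0), by
    have hu : u.1 0 + ∑ i : Fin k, u.1 i.succ = 1 := by
      rw [← Fin.sum_univ_succ]
      exact u.2.2
    have hle : u.1 0 ≤ 1 := (mem_Icc_of_mem_stdSimplex u.2 0).2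
    refine ⟨fun i => div_nonneg (u.2.1 _) (sub_nonneg.mpr hle), ?_⟩
    rw [← Finset.sum_div, div_eq_one_iff_eq (sub_ne_zero.mpr h.symm)]
    linarith⟩

theorem continuous_projectFace {k : ℕ} :
    Continuous fun u : {u : stdSimplex ℝ (Fin (k + 1)) // u.1 0 ≠ 1} => projectFace u.1 u.2 := by
  refine Continuous.subtype_mk (continuous_pi fun i => Continuous.div ?_ ?_ ?_) _
  · exact (continuous_apply _).comp (continuous_subtype_val.comp continuous_subtype_val)
  · exact continuous_const.sub
      ((continuous_apply _).comp (continuous_subtype_val.comp continuous_subtype_val))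
  · exact fun u => sub_ne_zero.mpr u.2.symm

open Classical in
/-- The cone over a singular simplex along a contraction `H` to the point `p`. -/
def coneSimplex (H : E × ℝ → E) (hH : Continuous H) (p : E) (h1 : ∀ x, H (x, 1) = p) {k : ℕ}
    (s : C(stdSimplex ℝ (Fin k), E)) : C(stdSimplex ℝ (Fin (k + 1)), E) where
  toFun u := if h : u.1 0 = 1 then p else H (s (projectFace u h), u.1 0)
  continuous_toFun := by
    have hc : Continuous fun u : stdSimplex ℝ (Fin (k + 1)) => u.1 0 :=
      (continuous_apply _).comp continuous_subtype_val
    rw [continuous_iff_continuousAt]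
    intro u
    by_cases hu : u.1 0 = 1
    · rw [ContinuousAt, dif_pos hu]
      intro O hO
      -- Near the apex the projection to the base has no limit, so the estimate must be uniform over
      -- the base; compactness of the image of `s` provides this.
      have hev : ∀ᶠ t in 𝓝 (1 : ℝ), ∀ x ∈ Set.range s, H (x, t) ∈ O := by
        refine (isCompact_range s.continuous).eventually_forall_of_forall_eventually fun x _ => ?_
        have : Filter.Tendsto (fun z : ℝ × E => H (z.2, z.1)) (𝓝 (1, x)) (𝓝 p) := by
          rw [← h1 x]
          exact (hH.comp continuous_swap).tendsto (1, x)
        exact this hO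
      rw [← hu] at hev
      rw [Filter.mem_map]
      filter_upwards [hc.continuousAt.eventually hev] with v hv
      rw [Set.mem_preimage]
      split_ifs with h
      · exact mem_of_mem_nhds hO
      · exact hv _ ⟨_, rfl⟩
    · have hopen : IsOpen {u : stdSimplex ℝ (Fin (k + 1)) | u.1 0 ≠ 1} :=
        isOpen_ne_fun hc continuous_const
      refine ContinuousOn.continuousAt (s := {u : stdSimplex ℝ (Fin (k + 1)) | u.1 0 ≠ 1}) ?_
        (hopen.mem_nhds hu)
      rw [continuousOn_iff_continuous_domRestrict]
      have : Continuous fun u : {u : stdSimplex ℝ (Fin (k + 1)) // u.1 0 ≠ 1} =>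
          H (s (projectFace u.1 u.2), u.1.1 0) :=
        hH.comp ((s.continuous.comp continuous_projectFace).prodMk (hc.comp continuous_subtype_val))
      refine this.congr fun u => ?_
      rw [Set.domRestrict_apply, dif_neg u.2]

theorem coneSimplex_of_eq {H : E × ℝ → E} (hH : Continuous H) {p : E} (h1 : ∀ x, H (x, 1) = p)
    {k : ℕ} (s : C(stdSimplex ℝ (Fin k), E)) {u : stdSimplex ℝ (Fin (k + 1))} (h : u.1 0 = 1) :
    coneSimplex H hH p h1 s u = p := dif_pos h

theorem coneSimplex_of_ne {H : E × ℝ → E} (hH : Continuous H) {p : E} (h1 : ∀ x, H (x, 1) = p)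
    {k : ℕ} (s : C(stdSimplex ℝ (Fin k), E)) {u : stdSimplex ℝ (Fin (k + 1))} (h : u.1 0 ≠ 1) :
    coneSimplex H hH p h1 s u = H (s (projectFace u h), u.1 0) := dif_neg h

theorem coneSimplex_comp_coface_zero {H : E × ℝ → E} (hH : Continuous H) {p : E}
    (h0 : ∀ x, H (x, 0) = x) (h1 : ∀ x, H (x, 1) = p) {k : ℕ}
    (s : C(stdSimplex ℝ (Fin k), E)) : (coneSimplex H hH p h1 s).comp (coface k 0) = s := by
  ext y
  have h : (coface k 0 y).1 0 = 0 := coface_apply_self 0 y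
  have hy : projectFace (coface k 0 y) (by rw [h]; exact zero_ne_one) = y := by
    refine Subtype.ext (funext fun i => ?_)
    have := coface_apply_succAbove 0 y i
    rw [Fin.zero_succAbove] at this
    simp only [projectFace, this, h, sub_zero, div_one]
  rw [ContinuousMap.comp_apply, coneSimplex_of_ne hH h1 s (by rw [h]; exact zero_ne_one), hy, h, h0]

theorem coneSimplex_comp_coface_succ {H : E × ℝ → E} (hH : Continuous H) {p : E}
    (h1 : ∀ x, H (x, 1) = p) {k : ℕ} (s : C(stdSimplex ℝ (Fin (k + 1)), E)) (i : Fin (k + 1)) :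
    (coneSimplex H hH p h1 s).comp (coface (k + 1) i.succ) =
      coneSimplex H hH p h1 (s.comp (coface k i)) := by
  ext u
  have h : (coface (k + 1) i.succ u).1 0 = u.1 0 := by
    have := coface_apply_succAbove i.succ u 0
    rwa [Fin.succ_succAbove_zero] at this
  rw [ContinuousMap.comp_apply]
  by_cases hu : u.1 0 = 1
  · rw [coneSimplex_of_eq hH h1 _ hu, coneSimplex_of_eq hH h1 _ (h.trans hu)]
  · rw [coneSimplex_of_ne hH h1 _ hu, coneSimplex_of_ne hH h1 _ (fun h' => hu (h.symm.trans h'))]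
    refine congrArg H (Prod.ext (congrArg s (Subtype.ext (funext fun l => ?_))) h)
    rcases Fin.eq_self_or_eq_succAbove i l with rfl | ⟨l, rfl⟩
    · rw [coface_apply_self]
      simp only [projectFace, coface_apply_self, zero_div]
    · rw [coface_apply_succAbove]
      have := coface_apply_succAbove i.succ u l.succ
      rw [Fin.succ_succAbove_succ] at this
      simp only [projectFace, this, h]

/-- A contractible set is acyclic. -/
theorem acyclicOn_of_contraction {Y : Set E} {H : E × ℝ → E} (hH : Continuous H) {p : E}
    (h0 : ∀ x, H (x, 0) = x) (h1 : ∀ x, H (x, 1) = p) (hp : p ∈ Y)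
    (hY : ∀ x ∈ Y, ∀ t ∈ Set.Icc (0 : ℝ) 1, H (x, t) ∈ Y) (k : ℕ) : AcyclicOn Y k := by
  intro φ hφ
  have hcone : ∀ {k : ℕ} (s : C(stdSimplex ℝ (Fin k), E)), LiesIn Y s →
      LiesIn Y (coneSimplex H hH p h1 s) := by
    intro k s hs u
    by_cases hu : u.1 0 = 1
    · rwa [coneSimplex_of_eq hH h1 s hu]
    · rw [coneSimplex_of_ne hH h1 s hu]
      exact hY _ (hs _) _ (mem_Icc_of_mem_stdSimplex u.2 0)
  cases k with
  | zero =>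
    intro s
    have := hφ _ (hcone s fun y => isEmptyElim y)
    rw [augCoboundary_apply, Fin.sum_univ_one, Fin.val_zero, pow_zero, one_mul,
      coneSimplex_comp_coface_zero hH h0 h1] at this
    exact this
  | succ k =>
    -- The cocycle identity on the cone over `s` expresses `φ s`, its zeroth face, through the cones
    -- over the faces of `s`.
    refine ⟨fun s => φ (coneSimplex H hH p h1 s), fun s hs => ?_⟩
    have := hφ _ (hcone s hs)
    rw [augCoboundary_apply, Fin.sum_univ_succ, Fin.val_zero, pow_zero, one_mul,
      coneSimplex_comp_coface_zero hH h0 h1] at this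
    rw [augCoboundary_apply, eq_neg_of_add_eq_zero_left this, ← Finset.sum_neg_distrib]
    refine Finset.sum_congr rfl fun i _ => ?_
    rw [coneSimplex_comp_coface_succ, Fin.val_succ, pow_succ]
    ring

end Cone

/-! ### The Mayer–Vietoris argument -/

section MayerVietoris

variable {E : Type*} [TopologicalSpace E]

/-- A cochain with a nonzero multiple that is a coboundary on `Y` is a coboundary on `Y`. -/
def TorsionFreeOn (Y : Set E) (k : ℕ) : Prop :=
  ∀ (φ : AugCochain E k) (m : ℤ), m ≠ 0 → CoboundaryOn Y k (m • φ) → CoboundaryOn Y k φ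

/-- The reduced cohomology of `Y` is torsion-free and concentrated in degree `N - 1`. -/
def ConcentratedOn (Y : Set E) (N : ℕ) : Prop :=
  ∀ k, TorsionFreeOn Y k ∧ (k ≠ N → AcyclicOn Y k)

theorem CocycleOn.mono {Y Z : Set E} (h : Y ⊆ Z) {k : ℕ} {φ : AugCochain E k}
    (hφ : CocycleOn Z k φ) : CocycleOn Y k φ := fun s hs => hφ s (hs.mono h)

theorem CoboundaryOn.mono {Y Z : Set E} (h : Y ⊆ Z) {k : ℕ} {φ : AugCochain E k}
    (hφ : CoboundaryOn Z k φ) : CoboundaryOn Y k φ := by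
  cases k with
  | zero => exact hφ
  | succ k =>
    obtain ⟨ψ, hψ⟩ := hφ
    exact ⟨ψ, fun s hs => hψ s (hs.mono h)⟩

theorem CoboundaryOn.cocycleOn {Y : Set E} {k : ℕ} {φ : AugCochain E k}
    (hφ : CoboundaryOn Y k φ) : CocycleOn Y k φ := by
  intro s hs
  cases k with
  | zero =>
    rw [augCoboundary_apply]
    exact Finset.sum_eq_zero fun _ _ => mul_eq_zero_of_right _ (hφ _)
  | succ k =>
    obtain ⟨ψ, hψ⟩ := hφ
    rw [augCoboundary_apply, Finset.sum_congr rfl fun i _ => by rw [← hψ _ (hs.comp (coface _ i))]]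
    exact congrFun (LinearMap.congr_fun (augCoboundary_comp E k) ψ) s

theorem CoboundaryOn.sub {Y : Set E} {k : ℕ} {φ φ' : AugCochain E k}
    (hφ : CoboundaryOn Y k φ) (hφ' : CoboundaryOn Y k φ') : CoboundaryOn Y k (φ - φ') := by
  cases k with
  | zero =>
    intro s
    rw [Pi.sub_apply, hφ, hφ', sub_zero]
  | succ k =>
    obtain ⟨ψ, hψ⟩ := hφ
    obtain ⟨ψ', hψ'⟩ := hφ'
    refine ⟨ψ - ψ', fun s hs => ?_⟩
    rw [map_sub, Pi.sub_apply, hψ s hs, hψ' s hs, Pi.sub_apply]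

theorem torsionFreeOn_zero (Y : Set E) : TorsionFreeOn Y 0 := fun _ _ hm h s =>
  (mul_eq_zero.mp (h s)).resolve_left hm

/-- If a nonzero multiple of `φ` is a cocycle then so is `φ`, because its coboundary has integer
values. -/
theorem AcyclicOn.torsionFreeOn {Y : Set E} {k : ℕ} (h : AcyclicOn Y k) : TorsionFreeOn Y k := by
  intro φ m hm hφ
  refine h φ fun s hs => ?_
  have := hφ.cocycleOn s hs
  rw [map_smul, Pi.smul_apply, smul_eq_mul] at this
  exact (mul_eq_zero.mp this).resolve_left hm

/-- A cocycle that is a coboundary on two relatively open sets, by means of cochains that differ by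
a coboundary on the intersection, is a coboundary on the union. -/
theorem coboundaryOn_of_cover {Y O₁ O₂ : Set E} (h₁ : IsOpen O₁) (h₂ : IsOpen O₂)
    (hY : Y ⊆ O₁ ∪ O₂) {k : ℕ} {φ : AugCochain E (k + 1)} (hφ : CocycleOn Y (k + 1) φ)
    {α β : AugCochain E k} (hα : ∀ s, LiesIn (Y ∩ O₁) s → augCoboundary E k α s = φ s)
    (hβ : ∀ s, LiesIn (Y ∩ O₂) s → augCoboundary E k β s = φ s)
    (hαβ : CoboundaryOn (Y ∩ O₁ ∩ O₂) k (α - β)) : CoboundaryOn Y (k + 1) φ := by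
  classical
  -- A primitive of `α - β` is a cochain on the ambient space, so its coboundary can be subtracted
  -- from `α` everywhere without changing `augCoboundary E k α`.
  obtain ⟨α', hα', hαβ'⟩ : ∃ α' : AugCochain E k,
      (∀ s, LiesIn (Y ∩ O₁) s → augCoboundary E k α' s = φ s) ∧
        ∀ s, LiesIn (Y ∩ O₁ ∩ O₂) s → α' s = β s := by
    cases k with
    | zero => exact ⟨α, hα, fun s _ => sub_eq_zero.mp (hαβ s)⟩
    | succ k =>
      obtain ⟨γ, hγ⟩ := hαβ
      refine ⟨α - augCoboundary E k γ, fun s hs => ?_, fun s hs => ?_⟩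
      · have := congrFun (LinearMap.congr_fun (augCoboundary_comp E k) γ) s
        rw [LinearMap.comp_apply] at this
        rw [map_sub, Pi.sub_apply, this, hα s hs]
        exact sub_zero _
      · rw [Pi.sub_apply, hγ s hs, Pi.sub_apply, sub_sub_cancel]
  -- The glued primitive. Its value on simplices contained in neither piece is immaterial.
  let η : AugCochain E k := fun s => if LiesIn (Y ∩ O₁) s then α' s else β s
  have hη₁ : ∀ s, LiesIn (Y ∩ O₁) s → η s = α' s := fun s hs => if_pos hs
  have hη₂ : ∀ s, LiesIn (Y ∩ O₂) s → η s = β s := by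
    intro s hs
    by_cases h : LiesIn (Y ∩ O₁) s
    · rw [hη₁ s h]
      exact hαβ' s fun y => ⟨h y, (hs y).2⟩
    · exact if_neg h
  have hδ : CocycleOn Y (k + 1) (augCoboundary E k η) := fun s _ =>
    congrFun (LinearMap.congr_fun (augCoboundary_comp E k) η) s
  obtain ⟨ψ, hψ⟩ := coboundaryOn_of_eq_zero h₁ h₂ hY (φ := φ - augCoboundary E k η)
    (fun s hs => by rw [map_sub, Pi.sub_apply, hφ s hs, hδ s hs, sub_zero])
    (fun s hs => by
      rw [Pi.sub_apply, ← hα' s hs, sub_eq_zero, augCoboundary_apply, augCoboundary_apply]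
      exact Finset.sum_congr rfl fun i _ => by rw [hη₁ _ (hs.comp _)])
    (fun s hs => by
      rw [Pi.sub_apply, ← hβ s hs, sub_eq_zero, augCoboundary_apply, augCoboundary_apply]
      exact Finset.sum_congr rfl fun i _ => by rw [hη₂ _ (hs.comp _)])
  refine ⟨ψ + η, fun s hs => ?_⟩
  rw [map_add, Pi.add_apply, hψ s hs, Pi.sub_apply, sub_add_cancel]

/-- Two primitives of a cocycle differ on the intersection by a cocycle one degree lower. Away from
the critical degrees this is a coboundary and gluing applies; in the critical degree only
torsion-freeness remains to be shown. -/
theorem concentratedOn_of_cover {Y O₁ O₂ : Set E} (h₁ : IsOpen O₁) (h₂ : IsOpen O₂)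
    (hY : Y ⊆ O₁ ∪ O₂) {N : ℕ} (hN₁ : ∀ k, AcyclicOn (Y ∩ O₁) k)
    (hN₂ : ConcentratedOn (Y ∩ O₂) (N + 1)) (hN : ConcentratedOn (Y ∩ O₁ ∩ O₂) N) :
    ConcentratedOn Y (N + 1) := by
  have hs₁ : Y ∩ O₁ ∩ O₂ ⊆ Y ∩ O₁ := fun x hx => hx.1
  have hs₂ : Y ∩ O₁ ∩ O₂ ⊆ Y ∩ O₂ := fun x hx => ⟨hx.1.1, hx.2⟩
  intro k
  cases k with
  | zero =>
    refine ⟨torsionFreeOn_zero Y, fun _ φ hφ => ?_⟩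
    -- In degree -1 the only simplex is the empty one, which lies in every set, so the claim for `Y
    -- ∩ O₁` is already the claim for `Y`.
    exact hN₁ 0 φ (hφ.mono Set.inter_subset_left)
  | succ k =>
    have hcocycle : ∀ φ : AugCochain E (k + 1), ∀ α β : AugCochain E k,
        (∀ s, LiesIn (Y ∩ O₁) s → augCoboundary E k α s = φ s) →
        (∀ s, LiesIn (Y ∩ O₂) s → augCoboundary E k β s = φ s) →
        CocycleOn (Y ∩ O₁ ∩ O₂) k (α - β) := by
      intro φ α β hα hβ s hs
      rw [map_sub, Pi.sub_apply, hα s (hs.mono hs₁), hβ s (hs.mono hs₂), sub_self]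
    constructor
    · by_cases hk : k = N
      · subst hk
        intro φ m hm h
        have hφ : CocycleOn Y (k + 1) φ := fun s hs => by
          have := h.cocycleOn s hs
          rw [map_smul, Pi.smul_apply, smul_eq_mul] at this
          exact (mul_eq_zero.mp this).resolve_left hm
        obtain ⟨α, hα⟩ := hN₁ (k + 1) φ (hφ.mono Set.inter_subset_left)
        obtain ⟨β, hβ⟩ := (hN₂ (k + 1)).1 φ m hm (h.mono Set.inter_subset_left)
        obtain ⟨ψ, hψ⟩ := h
        refine coboundaryOn_of_cover h₁ h₂ hY hφ hα hβ ((hN k).1 _ m hm ?_)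
        -- With `ψ` a primitive of `m • φ` on `Y`, both `m • α` and `m • β` differ from `ψ` by
        -- cocycles, which are coboundaries since index `k` is not critical on either piece. Hence
        -- `m • (α - β)` is a coboundary on the intersection, and `m` can be cancelled there.
        have e₁ : CoboundaryOn (Y ∩ O₁) k (m • α - ψ) := hN₁ k _ fun s hs => by
          rw [map_sub, map_smul, Pi.sub_apply, Pi.smul_apply, hα s hs,
            hψ s (hs.mono Set.inter_subset_left), Pi.smul_apply, sub_self]
        have e₂ : CoboundaryOn (Y ∩ O₂) k (m • β - ψ) := (hN₂ k).2 (by omega) _ fun s hs => by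
          rw [map_sub, map_smul, Pi.sub_apply, Pi.smul_apply, hβ s hs,
            hψ s (hs.mono Set.inter_subset_left), Pi.smul_apply, sub_self]
        have := (e₁.mono hs₁).sub (e₂.mono hs₂)
        rwa [sub_sub_sub_cancel_right, ← smul_sub] at this
      · refine AcyclicOn.torsionFreeOn fun φ hφ => ?_
        obtain ⟨α, hα⟩ := hN₁ (k + 1) φ (hφ.mono Set.inter_subset_left)
        obtain ⟨β, hβ⟩ := (hN₂ (k + 1)).2 (by omega) φ (hφ.mono Set.inter_subset_left)
        exact coboundaryOn_of_cover h₁ h₂ hY hφ hα hβ ((hN k).2 hk _ (hcocycle φ α β hα hβ))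
    · intro hk φ hφ
      obtain ⟨α, hα⟩ := hN₁ (k + 1) φ (hφ.mono Set.inter_subset_left)
      obtain ⟨β, hβ⟩ := (hN₂ (k + 1)).2 hk φ (hφ.mono Set.inter_subset_left)
      exact coboundaryOn_of_cover h₁ h₂ hY hφ hα hβ
        ((hN k).2 (by omega) _ (hcocycle φ α β hα hβ))

theorem concentratedOn_of_forall_acyclicOn {Y : Set E} (h : ∀ k, AcyclicOn Y k) (N : ℕ) :
    ConcentratedOn Y N := fun k => ⟨(h k).torsionFreeOn, fun _ => h k⟩

theorem concentratedOn_empty : ConcentratedOn (∅ : Set E) 0 := by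
  have h : ∀ k, AcyclicOn (∅ : Set E) (k + 1) := by
    intro k φ _
    -- A simplex with at least one vertex cannot lie in the empty set.
    exact ⟨0, fun s hs => (hs (stdVertices (k + 1) 0)).elim⟩
  intro k
  cases k with
  | zero => exact ⟨torsionFreeOn_zero _, fun h => (h rfl).elim⟩
  | succ k => exact ⟨(h k).torsionFreeOn, fun _ => h k⟩

end MayerVietoris

/-! ### Passage to retracts -/

section Retract

variable {E : Type*} [TopologicalSpace E] {X Y : Set E}

/-- A singular simplex that lies in `Y`, as a singular simplex of the subspace `Y`. -/
def LiesIn.restrict {k : ℕ} {s : C(stdSimplex ℝ (Fin k), E)} (hs : LiesIn Y s) :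
    C(stdSimplex ℝ (Fin k), Y) :=
  ⟨fun y => ⟨s y, hs y⟩, s.continuous.subtype_mk _⟩

open Classical in
/-- The pullback of a cochain along a map defined on `Y`, extended by zero. -/
def pullbackExtend (ν : C(Y, X)) {k : ℕ} (φ : AugCochain X k) : AugCochain E k :=
  fun s => if hs : LiesIn Y s then φ (ν.comp hs.restrict) else 0

theorem pullbackExtend_apply (ν : C(Y, X)) {k : ℕ} (φ : AugCochain X k)
    {s : C(stdSimplex ℝ (Fin k), E)} (hs : LiesIn Y s) :
    pullbackExtend ν φ s = φ (ν.comp hs.restrict) := dif_pos hs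

theorem augCoboundary_pullbackExtend (ν : C(Y, X)) {k : ℕ} (φ : AugCochain X k)
    {s : C(stdSimplex ℝ (Fin (k + 1)), E)} (hs : LiesIn Y s) :
    augCoboundary E k (pullbackExtend ν φ) s = augCoboundary X k φ (ν.comp hs.restrict) := by
  rw [augCoboundary_apply, augCoboundary_apply]
  exact Finset.sum_congr rfl fun i _ => by
    rw [pullbackExtend_apply ν φ (hs.comp _)]
    rfl

theorem pullbackExtend_smul (ν : C(Y, X)) {k : ℕ} (m : ℤ) (φ : AugCochain X k) :
    pullbackExtend ν (m • φ) = m • pullbackExtend ν φ := by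
  funext s
  simp only [pullbackExtend, Pi.smul_apply]
  split_ifs <;> simp

/-- The inclusion of a subset. -/
def setInclusion (X : Set E) : C(X, E) := ⟨Subtype.val, continuous_subtype_val⟩

theorem liesIn_setInclusion (hXY : X ⊆ Y) {k : ℕ} (s : C(stdSimplex ℝ (Fin k), X)) :
    LiesIn Y ((setInclusion X).comp s) := fun y => hXY (s y).2

theorem pullbackExtend_setInclusion {ν : C(Y, X)} (hXY : X ⊆ Y)
    (hν : ∀ x (hx : x ∈ X), (ν ⟨x, hXY hx⟩ : E) = x) {k : ℕ} (φ : AugCochain X k)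
    (s : C(stdSimplex ℝ (Fin k), X)) :
    pullbackExtend ν φ ((setInclusion X).comp s) = φ s := by
  rw [pullbackExtend_apply ν φ (liesIn_setInclusion hXY s)]
  congr 1
  exact ContinuousMap.ext fun y => Subtype.ext (hν _ (s y).2)

theorem coboundaryOn_pullbackExtend (ν : C(Y, X)) {k : ℕ} {φ : AugCochain X k}
    (h : φ ∈ augCoboundaries X k) : CoboundaryOn Y k (pullbackExtend ν φ) := by
  cases k with
  | zero =>
    intro s
    rw [(Submodule.mem_bot ℤ).mp h, pullbackExtend_apply ν _ (fun y => isEmptyElim y)]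
    rfl
  | succ k =>
    obtain ⟨ψ, rfl⟩ := h
    exact ⟨pullbackExtend ν ψ, fun s hs => by
      rw [augCoboundary_pullbackExtend ν ψ hs, pullbackExtend_apply ν _ hs]⟩

theorem mem_augCoboundaries_of_pullbackExtend {ν : C(Y, X)} (hXY : X ⊆ Y)
    (hν : ∀ x (hx : x ∈ X), (ν ⟨x, hXY hx⟩ : E) = x) {k : ℕ} {φ : AugCochain X k}
    (h : CoboundaryOn Y k (pullbackExtend ν φ)) : φ ∈ augCoboundaries X k := by
  cases k with
  | zero =>
    refine (Submodule.mem_bot ℤ).mpr (funext fun s => ?_)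
    rw [← pullbackExtend_setInclusion hXY hν φ s, h]
    rfl
  | succ k =>
    obtain ⟨ψ, hψ⟩ := h
    refine ⟨fun s => ψ ((setInclusion X).comp s), funext fun s => ?_⟩
    rw [← pullbackExtend_setInclusion hXY hν φ s, ← hψ _ (liesIn_setInclusion hXY s)]
    rfl

/-- Since `ν` is a retraction, pulling back along it and then restricting to `X` is the identity, so
the cohomology of `X` embeds in that of `Y`. No homotopy between `ν` and the identity is required.
-/
theorem ConcentratedOn.torsionFreeConcentrated {ν : C(Y, X)} (hXY : X ⊆ Y)
    (hν : ∀ x (hx : x ∈ X), (ν ⟨x, hXY hx⟩ : E) = x) {N : ℕ} (h : ConcentratedOn Y N) :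
    TorsionFreeConcentrated X ((N : ℤ) - 1) := by
  intro k
  constructor
  · refine ⟨fun m hm => ?_⟩
    intro a b hab
    rw [← sub_eq_zero]
    have hab' : (m : ℤ) • (a - b) = 0 := by
      rw [natCast_zsmul, smul_sub, sub_eq_zero]
      exact hab
    obtain ⟨c, hc⟩ := Submodule.Quotient.mk_surjective _ (a - b)
    rw [← hc] at hab' ⊢
    rw [← Submodule.Quotient.mk_smul, Submodule.Quotient.mk_eq_zero] at hab'
    rw [Submodule.Quotient.mk_eq_zero]
    refine mem_augCoboundaries_of_pullbackExtend hXY hν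
      ((h k).1 _ (m : ℤ) (by exact_mod_cast hm) ?_)
    rw [← pullbackExtend_smul]
    exact coboundaryOn_pullbackExtend ν hab'
  · intro hk
    rw [Submodule.Quotient.subsingleton_iff, eq_top_iff]
    intro c _
    refine mem_augCoboundaries_of_pullbackExtend hXY hν ((h k).2 (by omega) _ fun s hs => ?_)
    rw [augCoboundary_pullbackExtend ν _ hs]
    exact congrFun (LinearMap.mem_ker.mp c.2) _

end Retract

/-! ### Cones over joins of discrete sets -/

section Join

variable {V I : Type*}

/-- The points `x` of the cone over the join of copies of `I` such that the coordinates in `F` are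
positive. -/
def coneStar (F : Finset (V × I)) : Set (V × I → ℝ) :=
  {x | (∀ b, 0 ≤ x b) ∧ Set.InjOn Prod.fst {b | x b ≠ 0} ∧ ∀ f ∈ F, 0 < x f}

/-- The points of `coneStar F` at least one of whose coordinates in `A` is positive. -/
def openStar (F A : Finset (V × I)) : Set (V × I → ℝ) :=
  {x | x ∈ coneStar F ∧ ∃ a ∈ A, 0 < x a}

open Classical in
/-- A homotopy to the indicator function of `insert a F`: in the first half, the coordinates over
`a.1` other than `a` are shrunk to zero; in the second half, the homotopy is linear. -/
def starHomotopy (F : Finset (V × I)) (a : V × I) (z : (V × I → ℝ) × ℝ) : V × I → ℝ := fun b =>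
  (1 - max 0 (2 * z.2 - 1)) * ((if b.1 = a.1 ∧ b ≠ a then max 0 (1 - 2 * z.2) else 1) * z.1 b) +
    max 0 (2 * z.2 - 1) * (if b ∈ insert a F then 1 else 0)

theorem continuous_starHomotopy (F : Finset (V × I)) (a : V × I) :
    Continuous (starHomotopy F a) := by
  refine continuous_pi fun b => ?_
  unfold starHomotopy
  split_ifs <;> fun_prop

theorem starHomotopy_zero (F : Finset (V × I)) (a : V × I) (x : V × I → ℝ) :
    starHomotopy F a (x, 0) = x := by
  funext b
  simp [starHomotopy]

open Classical in
theorem starHomotopy_one (F : Finset (V × I)) (a : V × I) (x : V × I → ℝ) :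
    starHomotopy F a (x, 1) = fun b => if b ∈ insert a F then 1 else 0 := by
  funext b
  norm_num [starHomotopy]

theorem starHomotopy_of_le (F : Finset (V × I)) (a : V × I) (x : V × I → ℝ) {t : ℝ}
    (ht : t ≤ 1 / 2) (b : V × I) : ∃ c : ℝ, 0 ≤ c ∧ starHomotopy F a (x, t) b = c * x b ∧
      ((b = a ∨ b.1 ≠ a.1) → c = 1) := by
  classical
  have h1 : max 0 (2 * t - 1) = 0 := max_eq_left (by linarith)
  refine ⟨if b.1 = a.1 ∧ b ≠ a then max 0 (1 - 2 * t) else 1, ?_, ?_, ?_⟩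
  · split_ifs
    · exact le_max_left _ _
    · exact zero_le_one
  · simp [starHomotopy, h1]
  · rintro (h | h) <;> simp [h]

open Classical in
theorem starHomotopy_of_ge (F : Finset (V × I)) (a : V × I) (x : V × I → ℝ) {t : ℝ}
    (ht : 1 / 2 ≤ t) (b : V × I) : starHomotopy F a (x, t) b =
      (2 - 2 * t) * (if b.1 = a.1 ∧ b ≠ a then 0 else x b) +
        (2 * t - 1) * (if b ∈ insert a F then 1 else 0) := by
  have h1 : max 0 (2 * t - 1) = 2 * t - 1 := max_eq_right (by linarith)
  have h2 : max 0 (1 - 2 * t) = 0 := max_eq_left (by linarith)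
  simp only [starHomotopy, h1, h2, ite_mul, zero_mul, one_mul]
  ring

/-- In the first half no coordinate becomes nonzero and `b` keeps its value. In the second half `a`
is positive and the rest of its copy is zero, so adding the indicator preserves the
one-coordinate-per-copy condition. -/
theorem starHomotopy_mem {F : Finset (V × I)} {a : V × I} (ha : ∀ f ∈ F, f.1 ≠ a.1)
    {x : V × I → ℝ} (hx : x ∈ coneStar F) {b : V × I} (hb : b = a ∨ b.1 ≠ a.1) (hxb : 0 < x b)
    {t : ℝ} (ht : t ∈ Set.Icc (0 : ℝ) 1) :
    starHomotopy F a (x, t) ∈ coneStar F ∧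
      (0 < starHomotopy F a (x, t) a ∨ 0 < starHomotopy F a (x, t) b) := by
  classical
  obtain ⟨hx0, hxi, hxF⟩ := hx
  rcases le_or_gt t (1 / 2) with h | h
  · choose c hc hH hc1 using starHomotopy_of_le F a x h
    refine ⟨⟨fun b => ?_, hxi.mono fun b hb => ?_, fun f hf => ?_⟩, Or.inr ?_⟩
    · rw [hH]
      exact mul_nonneg (hc b) (hx0 b)
    · rw [Set.mem_ofPred_eq, hH] at hb
      exact right_ne_zero_of_mul hb
    · rw [hH, hc1 f (Or.inr (ha f hf)), one_mul]
      exact hxF f hf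
    · rw [hH, hc1 b hb, one_mul]
      exact hxb
  · have h2 : 0 ≤ 2 - 2 * t := by linarith [ht.2]
    have h1 : 0 < 2 * t - 1 := by linarith
    have hpos : ∀ f ∈ insert a F, 0 < starHomotopy F a (x, t) f := by
      intro f hf
      rw [starHomotopy_of_ge F a x h.le, if_pos hf]
      have : 0 ≤ (if f.1 = a.1 ∧ f ≠ a then 0 else x f) := by
        split_ifs
        · exact le_rfl
        · exact hx0 f
      have := mul_nonneg h2 this
      linarith
    -- The elements of `F` are already in the support of `x`, so only `a` can be new.
    have hsupp : ∀ b, starHomotopy F a (x, t) b ≠ 0 → b = a ∨ (b.1 ≠ a.1 ∧ x b ≠ 0) := by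
      intro b hb
      by_contra hcon
      push Not at hcon
      refine hb ?_
      rw [starHomotopy_of_ge F a x h.le]
      have hbF : b ∉ insert a F := by
        rw [Finset.mem_insert]
        rintro (h | h)
        · exact hcon.1 h
        · exact (hxF b h).ne' (hcon.2 (ha b h))
      rw [if_neg hbF]
      split_ifs with hba
      · ring
      · rw [hcon.2 fun h => hba ⟨h, hcon.1⟩]
        ring
    refine ⟨⟨fun b => ?_, ?_, fun f hf => hpos f (Finset.mem_insert_of_mem hf)⟩,
      Or.inl (hpos a (Finset.mem_insert_self a F))⟩
    · rw [starHomotopy_of_ge F a x h.le]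
      refine add_nonneg (mul_nonneg h2 ?_) (mul_nonneg h1.le ?_)
      · split_ifs
        · exact le_rfl
        · exact hx0 b
      · split_ifs
        · exact zero_le_one
        · exact le_rfl
    · intro b hb c hc hbc
      rcases hsupp b hb with rfl | ⟨hb1, hb2⟩ <;> rcases hsupp c hc with rfl | ⟨hc1, hc2⟩
      · rfl
      · exact (hc1 hbc.symm).elim
      · exact (hb1 hbc).elim
      · exact hxi hb2 hc2 hbc

open Classical in
theorem indicator_mem_coneStar {F : Finset (V × I)} {a : V × I} (ha : ∀ f ∈ F, f.1 ≠ a.1)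
    (hF : Set.InjOn Prod.fst (F : Set (V × I))) :
    (fun b => if b ∈ insert a F then (1 : ℝ) else 0) ∈ coneStar F := by
  refine ⟨fun b => ?_, ?_, fun f hf => ?_⟩
  · dsimp only
    split_ifs
    · exact zero_le_one
    · exact le_rfl
  · intro b hb c hc hbc
    have hb' : b ∈ insert a F := by
      by_contra h
      exact hb (if_neg h)
    have hc' : c ∈ insert a F := by
      by_contra h
      exact hc (if_neg h)
    rw [Finset.mem_insert] at hb' hc'
    rcases hb' with rfl | hb' <;> rcases hc' with rfl | hc'
    · rfl
    · exact (ha c hc' hbc.symm).elim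
    · exact (ha b hb' hbc).elim
    · exact hF hb' hc' hbc
  · dsimp only
    rw [if_pos (Finset.mem_insert_of_mem hf)]
    exact zero_lt_one

theorem acyclicOn_openStar_inter {F A : Finset (V × I)} {a : V × I} (haA : a ∈ A)
    (ha : ∀ f ∈ F, f.1 ≠ a.1) (hF : Set.InjOn Prod.fst (F : Set (V × I))) (k : ℕ) :
    AcyclicOn (openStar F A ∩ {x | 0 < x a}) k := by
  classical
  refine acyclicOn_of_contraction (continuous_starHomotopy F a) (starHomotopy_zero F a)
    (starHomotopy_one F a) ?_ ?_ k
  · have : 0 < (fun b => if b ∈ insert a F then (1 : ℝ) else 0) a := by simp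
    exact ⟨⟨indicator_mem_coneStar ha hF, a, haA, this⟩, this⟩
  · rintro x ⟨⟨hx, -⟩, hxa⟩ t ht
    obtain ⟨h1, h2⟩ := starHomotopy_mem ha hx (Or.inl rfl) hxa ht
    have h2 := h2.elim id id
    exact ⟨⟨h1, a, haA, h2⟩, h2⟩

/-- When `a` is the only element of `A` in its copy, shrinking the rest of that copy removes no
positive coordinate in `A`; the coordinate `b` witnesses membership until `a` takes over. -/
theorem acyclicOn_openStar {F A : Finset (V × I)} {a : V × I} (haA : a ∈ A)
    (ha : ∀ f ∈ F, f.1 ≠ a.1) (hF : Set.InjOn Prod.fst (F : Set (V × I)))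
    (hA : ∀ b ∈ A, b.1 = a.1 → b = a) (k : ℕ) : AcyclicOn (openStar F A) k := by
  classical
  refine acyclicOn_of_contraction (continuous_starHomotopy F a) (starHomotopy_zero F a)
    (starHomotopy_one F a) ?_ ?_ k
  · exact ⟨indicator_mem_coneStar ha hF, a, haA, by simp⟩
  · rintro x ⟨hx, b, hbA, hxb⟩ t ht
    obtain ⟨h1, h2⟩ := starHomotopy_mem ha hx
      (b := b) (or_iff_not_imp_right.mpr fun h => hA b hbA (not_not.mp h)) hxb ht
    exact ⟨h1, h2.elim (fun h => ⟨a, haA, h⟩) fun h => ⟨b, hbA, h⟩⟩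

/-- If the copies of `I` are divided into those that contain exactly one element of `F` and those
that contain an element of `A`, then the reduced cohomology of `openStar F A` is torsion-free and
concentrated in one degree. -/
theorem concentratedOn_openStar [Fintype V] (A : Finset (V × I)) :
    ∀ (F : Finset (V × I)) (N : ℕ), Set.InjOn Prod.fst (F : Set (V × I)) →
      (∀ v, (∃ f ∈ F, f.1 = v) ↔ ¬ ∃ a ∈ A, a.1 = v) → N + F.card = Fintype.card V →
      ConcentratedOn (openStar F A) N := by
  classical
  induction A using Finset.strongInduction with
  | H A ih =>
    intro F N hF hFA hN
    have hcard : (F.image Prod.fst).card = F.card := Finset.card_image_of_injOn hF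
    rcases A.eq_empty_or_nonempty with rfl | ⟨a, haA⟩
    · have hun : F.image Prod.fst = Finset.univ := by
        refine Finset.eq_univ_of_forall fun v => Finset.mem_image.mpr ?_
        exact (hFA v).mpr (by simp)
      rw [hun, Finset.card_univ] at hcard
      have hN0 : N = 0 := by omega
      have hempty : openStar F (∅ : Finset (V × I)) = ∅ := by
        refine Set.eq_empty_of_forall_notMem ?_
        rintro x ⟨-, b, hb, -⟩
        simp at hb
      rw [hN0, hempty]
      exact concentratedOn_empty
    · have ha : ∀ f ∈ F, f.1 ≠ a.1 := fun f hf h => (hFA a.1).mp ⟨f, hf, h⟩ ⟨a, haA, rfl⟩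
      by_cases hA : ∀ b ∈ A, b.1 = a.1 → b = a
      · exact concentratedOn_of_forall_acyclicOn (acyclicOn_openStar haA ha hF hA) N
      · push Not at hA
        obtain ⟨a', ha'A, ha'1, ha'⟩ := hA
        -- The copy of `a` is missed by `F`, so `N` is positive and the degree can be lowered.
        have hlt : F.card < Fintype.card V := by
          rw [← hcard]
          refine Finset.card_lt_univ_of_notMem (x := a.1) fun h => ?_
          obtain ⟨f, hf, hfa⟩ := Finset.mem_image.mp h
          exact ha f hf hfa
        obtain ⟨M, rfl⟩ : ∃ M, N = M + 1 := ⟨N - 1, by omega⟩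
        have haF : a ∉ F := fun h => ha a h rfl
        have h₂ : openStar F A ∩ {x | ∃ b ∈ A.erase a, 0 < x b} = openStar F (A.erase a) := by
          ext x
          constructor
          · rintro ⟨⟨hx, -⟩, h⟩
            exact ⟨hx, h⟩
          · rintro ⟨hx, b, hb, hxb⟩
            exact ⟨⟨hx, b, Finset.mem_of_mem_erase hb, hxb⟩, b, hb, hxb⟩
        have h₁₂ : openStar F A ∩ {x | 0 < x a} ∩ {x | ∃ b ∈ A.erase a, 0 < x b} =
            openStar (insert a F) (A.filter fun b => b.1 ≠ a.1) := by
          ext x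
          constructor
          · rintro ⟨⟨⟨⟨hx0, hxi, hxF⟩, -⟩, hxa⟩, b, hb, hxb⟩
            refine ⟨⟨hx0, hxi, fun f hf => ?_⟩, b, Finset.mem_filter.mpr
              ⟨Finset.mem_of_mem_erase hb, fun h => Finset.ne_of_mem_erase hb
                (hxi hxb.ne' (ne_of_gt hxa) h)⟩, hxb⟩
            rcases Finset.mem_insert.mp hf with rfl | hf
            · exact hxa
            · exact hxF f hf
          · rintro ⟨⟨hx0, hxi, hxF⟩, b, hb, hxb⟩
            obtain ⟨hbA, hba⟩ := Finset.mem_filter.mp hb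
            have hxa : 0 < x a := hxF a (Finset.mem_insert_self a F)
            exact ⟨⟨⟨⟨hx0, hxi, fun f hf => hxF f (Finset.mem_insert_of_mem hf)⟩, a, haA, hxa⟩,
              hxa⟩, b, Finset.mem_erase.mpr ⟨fun h => hba (by rw [h]), hbA⟩, hxb⟩
        have ho₁ : IsOpen {x : V × I → ℝ | 0 < x a} :=
          isOpen_lt continuous_const (continuous_apply a)
        have ho₂ : IsOpen {x : V × I → ℝ | ∃ b ∈ A.erase a, 0 < x b} := by
          have : {x : V × I → ℝ | ∃ b ∈ A.erase a, 0 < x b} =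
              ⋃ b ∈ A.erase a, {x : V × I → ℝ | 0 < x b} := by
            ext x
            simp
          rw [this]
          exact isOpen_biUnion fun b _ => isOpen_lt continuous_const (continuous_apply b)
        refine concentratedOn_of_cover ho₁ ho₂ ?_ (acyclicOn_openStar_inter haA ha hF) ?_ ?_
        · rintro x ⟨-, b, hbA, hxb⟩
          by_cases hba : b = a
          · exact Or.inl (hba ▸ hxb)
          · exact Or.inr ⟨b, Finset.mem_erase.mpr ⟨hba, hbA⟩, hxb⟩
        · rw [h₂]
          refine ih _ (Finset.erase_ssubset haA) F (M + 1) hF (fun v => ?_) hN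
          rw [hFA v, not_iff_not]
          constructor
          · rintro ⟨b, hbA, hbv⟩
            by_cases hba : b = a
            -- The second element `a'` keeps the copy of `a` represented after `a` is erased.
            · exact ⟨a', Finset.mem_erase.mpr ⟨ha', ha'A⟩, by rw [ha'1, ← hba, hbv]⟩
            · exact ⟨b, Finset.mem_erase.mpr ⟨hba, hbA⟩, hbv⟩
          · rintro ⟨b, hb, hbv⟩
            exact ⟨b, Finset.mem_of_mem_erase hb, hbv⟩
        · rw [h₁₂]
          refine ih _ ?_ (insert a F) M ?_ (fun v => ?_) ?_
          · exact Finset.filter_ssubset.mpr ⟨a, haA, by simp⟩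
          · rw [Finset.coe_insert, Set.injOn_insert (by simpa using haF)]
            refine ⟨hF, ?_⟩
            rintro ⟨f, hf, hfa⟩
            exact ha f hf hfa
          · constructor
            · rintro ⟨f, hf, rfl⟩ ⟨b, hb, hbf⟩
              obtain ⟨hbA, hba⟩ := Finset.mem_filter.mp hb
              rcases Finset.mem_insert.mp hf with rfl | hf
              · exact hba hbf
              · exact (hFA f.1).mp ⟨f, hf, rfl⟩ ⟨b, hbA, hbf⟩
            · intro h
              by_cases hv : v = a.1
              · exact ⟨a, Finset.mem_insert_self a F, hv.symm⟩
              · obtain ⟨f, hf, hfv⟩ := (hFA v).mpr fun ⟨b, hbA, hbv⟩ =>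
                  h ⟨b, Finset.mem_filter.mpr ⟨hbA, fun h' => hv (by rw [← hbv, h'])⟩, hbv⟩
                exact ⟨f, Finset.mem_insert_of_mem hf, hfv⟩
          · rw [Finset.card_insert_of_notMem haF]
            omega

end Join

/-! ### Complements of simplices -/

section Complement

variable {p : ℕ} {V : Type*} [Fintype V]

theorem mem_geomRealization_joinComplex {x : V × Fin (p + 1) → ℝ} :
    x ∈ geomRealization (joinComplex p V) ↔
      x ∈ stdSimplex ℝ (V × Fin (p + 1)) ∧ Set.InjOn Prod.fst {b | x b ≠ 0} := by
  classical
  constructor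
  · intro hx
    obtain ⟨s, hs, hxs⟩ := Set.mem_iUnion₂.mp hx
    refine ⟨hxs.1, ((exists_tupleSimplex_iff s).mp hs.2).mono fun b hb => ?_⟩
    by_contra h
    exact hb (hxs.2 b h)
  · rintro ⟨hx, hxi⟩
    have hcoe : ((Finset.univ.filter fun b => x b ≠ 0 : Finset (V × Fin (p + 1))) :
        Set (V × Fin (p + 1))) = {b | x b ≠ 0} := by simp
    refine Set.mem_iUnion₂.mpr ⟨Finset.univ.filter fun b => x b ≠ 0, ⟨?_, ?_⟩, hx, ?_⟩
    · by_contra h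
      rw [Finset.not_nonempty_iff_eq_empty, Finset.filter_eq_empty_iff] at h
      have := hx.2
      rw [Finset.sum_eq_zero fun b hb => not_not.mp (h hb)] at this
      exact zero_ne_one this
    · rw [exists_tupleSimplex_iff, hcoe]
      exact hxi
    · intro b hb
      simpa using hb

/-- A point of the realization lies outside the closed simplex precisely because some coordinate off
`σ` is nonzero, hence positive. -/
theorem geomRealization_diff_subset [DecidableEq V] (σ : Finset (V × Fin (p + 1))) :
    geomRealization (joinComplex p V) \ closedSimplex σ ⊆ openStar ∅ σᶜ := by
  rintro x ⟨hx, hxσ⟩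
  rw [mem_geomRealization_joinComplex] at hx
  refine ⟨⟨hx.1.1, hx.2, by simp⟩, ?_⟩
  by_contra h
  push Not at h
  exact hxσ ⟨hx.1, fun b hb => le_antisymm (h b (Finset.mem_compl.mpr hb)) (hx.1.1 b)⟩

theorem sum_pos_of_mem_openStar {F A : Finset (V × Fin (p + 1))} {x : V × Fin (p + 1) → ℝ}
    (hx : x ∈ openStar F A) : 0 < ∑ b, x b := by
  obtain ⟨hx, a, -, hxa⟩ := hx
  exact Finset.sum_pos' (fun b _ => hx.1 b) ⟨a, Finset.mem_univ a, hxa⟩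

/-- The division by the sum of the coordinates. -/
def normalizeSum [DecidableEq V] (σ : Finset (V × Fin (p + 1))) :
    C(openStar ∅ σᶜ, ↥(geomRealization (joinComplex p V) \ closedSimplex σ)) where
  toFun x := ⟨fun b => x.1 b / ∑ c, x.1 c, by
    have hs := sum_pos_of_mem_openStar x.2
    obtain ⟨⟨hx0, hxi, -⟩, a, ha, hxa⟩ := x.2
    refine ⟨mem_geomRealization_joinComplex.mpr ⟨⟨fun b => div_nonneg (hx0 b) hs.le, ?_⟩, ?_⟩, ?_⟩
    · rw [← Finset.sum_div, div_self hs.ne']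
    · exact hxi.mono fun b hb => (div_ne_zero_iff.mp hb).1
    · intro h
      exact (div_pos hxa hs).ne' (h.2 a (Finset.mem_compl.mp ha))⟩
  continuous_toFun := by
    refine Continuous.subtype_mk (continuous_pi fun b => Continuous.div ?_ ?_ ?_) _
    · exact (continuous_apply b).comp continuous_subtype_val
    · exact continuous_finsetSum _ fun c _ => (continuous_apply c).comp continuous_subtype_val
    · exact fun x => (sum_pos_of_mem_openStar x.2).ne'

end Complement

end

theorem lemma3p4 (n p : ℕ) (hp : 1 ≤ p) (V : Type*) [Fintype V] (hV : Fintype.card V = n) :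
    IsPH (joinComplex p V) ((n : ℤ) - 1) := by
  classical
  intro σ hσ
  have hinj : Set.InjOn Prod.fst (σ : Set (V × Fin (p + 1))) := by
    rcases hσ with rfl | hσ
    · simp
    · exact (exists_tupleSimplex_iff σ).mp hσ.2
  refine ConcentratedOn.torsionFreeConcentrated (ν := normalizeSum σ)
    (geomRealization_diff_subset σ) (fun x hx => funext fun b => ?_)
    (concentratedOn_openStar σᶜ ∅ n (by simp) (fun v => ?_) (by simp [hV]))
  -- Points of the realization have coordinate sum 1, so the normalisation fixes them.
  · change x b / ∑ c, x c = x b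
    rw [(mem_geomRealization_joinComplex.mp hx.1).1.2, div_one]
  · simp only [Finset.notMem_empty, false_and, exists_false, false_iff, not_not]
    by_contra h
    push Not at h
    have h0 : ∀ i, (v, i) ∈ σ := fun i => by
      by_contra hi
      exact h (v, i) (Finset.mem_compl.mpr hi) rfl
    -- A copy contained in `σ` would contribute the vertices `0` and `p`, which are distinct because
    -- `p ≥ 1`, while `σ` has at most one vertex per copy. So `σᶜ` meets every copy.
    have h01 := congrArg Prod.snd (hinj (h0 0) (h0 (Fin.last p)) rfl)
    have := congrArg Fin.val h01
    simp at this
    omega
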